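/- Let $\mu$ be a probability measure on $\mathbb Z^2$ and let $\mathbb N^*=\{1,2,\dots\}$. Assume: (H1) the homogeneous random walk $S(t)=(S_1(t),S_2(t))$ on $\mathbb Z^2$ with transition probabilities $p_S(z,z')=\mu(z'-z)$ is irreducible and $\sum_{z\in\mathbb Z^2} z\,\mu(z)\neq 0$; (H2) the random walk with substochastic transition matrix $(\mu(z'-z))_{z,z'\in\mathbb N^*\times\mathbb N^*}$ (that is, $S$ killed when it first leaves $\mathbb N^*\times\mathbb N^*$) is irreducible on $\mathbb N^*\times\mathbb N^*$; (H3) $\varphi(a)=\sum_{z\in\mathbb Z^2}\mu(z)e^{a\cdot z}$ is finite for every $a\in\mathbb R^2$; (H4) $S_1$ and $S_2$ are aperiodic random walks on $\mathbb Z$. Let $a(1,0)$ be the unique point $a\in\mathbb R^2$ with $\varphi(a)=1$ and $\nabla\varphi(a)/|\nabla\varphi(a)|=(1,0)$. Let $Z^1_+$ be the random walk on $\mathbb Z\times\mathbb N^*$ with substochastic transition matrix $(\mu(z'-z))_{z,z'\in\mathbb Z\times\mathbb N^*}$, and let $G^1_+(z,z')=\sum_{n\ge 0}\mathbb P_z(Z^1_+(n)=z')$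 be its Green function. Then $0<G^1_+(z,z')<\infty$ for all $z,z'\in\mathbb Z\times\mathbb N^*$, and the following holds. Let $z_*\in\mathbb Z\times\mathbb N^*$ be a fixed reference point, and let $(z_n)$ be a sequence in $\mathbb N^*\times\mathbb N^*$ with $\lim_n|z_n|=+\infty$ and $\lim_n z_n/|z_n|=(1,0)$, where $|\cdot|$ is the Euclidean norm. Then for every $\sigma>0$ there are $C>0$, $\delta>0$ and $N>0$ such that $$\frac{G^1_+(z,z_n)}{G^1_+(z_*,z_n)}\le C\exp\bigl(a(1,0)\cdot z+\sigma|z|\bigr)$$ for all $n\ge N$ and all $z\in\mathbb Z\times\mathbb N^*$ with $|z|<\delta|z_n|$. -/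

import Mathlib

open Filter Topology
open scoped ENNReal

noncomputable section

namespace KilledWalk

/-- The `n`-step transition probabilities of the Markov chain with (sub)stochastic transition
matrix `p`, that is, the entries of the `n`-th power of `p`. -/
def nStep {α : Type*} (p : α → α → ℝ≥0∞) : ℕ → α → α → ℝ≥0∞
  | 0, z, z' => Set.indicator {z} (fun _ => 1) z'
  | n + 1, z, z' => ∑' w, p z w * nStep p n w z'

/-- The Green function `∑ n, ℙ_z (Z(n) = z')` of the chain with transition matrix `p`. -/
def green {α : Type*} (p : α → α → ℝ≥0∞) (z z' : α) : ℝ≥0∞ :=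
  ∑' n : ℕ, nStep p n z z'

/-- The chain with transition matrix `p` is irreducible on the set `E`. -/
def IrreducibleOn {α : Type*} (p : α → α → ℝ≥0∞) (E : Set α) : Prop :=
  ∀ z ∈ E, ∀ z' ∈ E, ∃ n : ℕ, 0 < nStep p n z z'

/-- Every state has period one: the return times `k > 0` of positive probability have greatest
common divisor `1`. -/
def Aperiodic {α : Type*} (p : α → α → ℝ≥0∞) : Prop :=
  ∀ z : α, ∀ d : ℕ, (∀ k : ℕ, 0 < k → 0 < nStep p k z z → d ∣ k) → d = 1

/-- The transition matrix `p(z, z') = μ(z' - z)` of the homogeneous random walk with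
jump law `μ`. -/
def walkKernel {A : Type*} [AddCommGroup A] (μ : PMF A) (z z' : A) : ℝ≥0∞ :=
  μ (z' - z)

open Classical in
/-- The substochastic transition matrix `(μ(z' - z), z, z' ∈ E)` of the random walk with jump
law `μ` killed when it first leaves `E`, extended by zero to all pairs of points. -/
def killedKernel {A : Type*} [AddCommGroup A] (μ : PMF A) (E : Set A) (z z' : A) : ℝ≥0∞ :=
  if z ∈ E ∧ z' ∈ E then μ (z' - z) else 0

/-- The quadrant `ℕ* × ℕ*`. -/
def quadrant : Set (ℤ × ℤ) := {z | 0 < z.1 ∧ 0 < z.2}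

/-- The half-plane `ℤ × ℕ*`. -/
def halfPlane : Set (ℤ × ℤ) := {z | 0 < z.2}

/-- The Green function of the random walk with jump law `μ` on `ℤ × ℕ*`, killed when it first
leaves `ℤ × ℕ*`. -/
def greenHalfPlane (μ : PMF (ℤ × ℤ)) (z z' : ℤ × ℤ) : ℝ≥0∞ :=
  green (killedKernel μ halfPlane) z z'

/-- A lattice point as a vector of the Euclidean plane. -/
def toPlane (z : ℤ × ℤ) : EuclideanSpace ℝ (Fin 2) := !₂[(z.1 : ℝ), (z.2 : ℝ)]

/-- The general term `μ(z) exp(a · z)` of the jump generating function. -/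
def expTerm (μ : PMF (ℤ × ℤ)) (a : EuclideanSpace ℝ (Fin 2)) (z : ℤ × ℤ) : ℝ :=
  (μ z).toReal * Real.exp (inner ℝ a (toPlane z))

/-- The jump generating function `φ(a) = ∑ z, μ(z) exp(a · z)`. -/
def jumpGen (μ : PMF (ℤ × ℤ)) (a : EuclideanSpace ℝ (Fin 2)) : ℝ :=
  ∑' z, expTerm μ a z

/-- The mean jump `m = ∑ z, z μ(z)`. -/
def meanJump (μ : PMF (ℤ × ℤ)) : EuclideanSpace ℝ (Fin 2) :=
  ∑' z, (μ z).toReal • toPlane z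

/-- The outer unit normal `∇φ(a) / |∇φ(a)|` at the point `a` of the curve `φ = 1`. -/
def normalDir (μ : PMF (ℤ × ℤ)) (a : EuclideanSpace ℝ (Fin 2)) : EuclideanSpace ℝ (Fin 2) :=
  ‖gradient (jumpGen μ) a‖⁻¹ • gradient (jumpGen μ) a

/-- The point `a(q)`: the inverse at `q / |q|` of the map `normalDir μ` from the curve `φ = 1`
(the boundary of `{φ ≤ 1}`) to the unit circle. -/
def normalPoint (μ : PMF (ℤ × ℤ)) (q : EuclideanSpace ℝ (Fin 2)) : EuclideanSpace ℝ (Fin 2) :=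
  Function.invFunOn (normalDir μ) {a | jumpGen μ a = 1} (‖q‖⁻¹ • q)

end KilledWalk

end

/-!
After the exponential change of measure `ν(z) = μ(z) exp(a · z)`, `a = a(1,0)`, the walk is a
probability walk with drift `(c, 0)`, `c > 0`, and the claim becomes
`G(z, w) ≤ C exp(σ |z|) G(z₀, w)` for its Green function `G` on the half-plane, for targets `w` far
away in the direction `(1, 0)` and starting points `z` much closer to the origin than `w`. A bound
by Harnack's inequality (`harnack`) only gives some fixed exponential rate. To bring the rate down
to `σ`, the two coordinate directions are treated separately.

*Horizontally*, `G(z ± (1, 0), w) ≤ exp(σ) G(z, w)` (`HorizontalDrift.exists_horizontal_ratio`).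
Some power `X` of the transition operator `P` of the killed walk splits as `X = ε T + Q`, where `T`
is the translation by `(1, 0)` and commutes with `Q`. In the binomial expansion of `X ^ n` the
number of factors `T` concentrates around `ε n`, and one factor more or less changes a binomial
term by a factor close to one. Thus `T X ^ n` and `X ^ (n + 1)` agree up to a factor `1 + σ` and up
to the atypical terms (`shift_pow_le`, `pow_succ_le_shift_pow`). The latter are dominated by the
powers of a multiple of `ρ ε T + Q` that is strictly contracting on a weight `exp(b z₁)`, `b > 0`,
so they contribute at most `exp(-b (w₁ - z₁))`. This is negligible, because `G(z, w)` decays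
subexponentially in the direction of the drift (`HorizontalDrift.exists_le_green`).

*Vertically*, the walk climbs by `L` levels with probability at least `exp(-σ L)` for some `L ≥ 1`
(`HorizontalDrift.exists_climb`). Hence `G(·, w)` at height `y + L` is at most `exp(σ L)` times a
value at height `y`, up to a bounded horizontal displacement, which the horizontal bound absorbs.

Both subexponential estimates come from the function `f(z) = (exp(θ z₂) - 1)⁺`, which satisfies
`P f ≥ φ(0, θ) f` with `φ(0, θ) > 1` for every `θ > 0`, `φ` being the generating function of `ν`:
its expectation along the killed walk cannot decay, nor even stay bounded, as it would if these
paths were too expensive.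

The point `a(1,0)` is obtained by maximising the first coordinate over the compact set
`{φ ≤ 1}`, now for the generating function of `μ`.
-/

open Filter Topology
open scoped ENNReal

noncomputable section

namespace KilledWalk

/-! ### Kernels as operators -/

section Operator

variable {α β : Type*}

/-- The operator `f ↦ (z ↦ ∑ w, p(z, w) f(w))` of a kernel `p` on functions with values in
`[0, ∞]`. Every sum converges there, and the operators form a semiring. -/
def op (p : α → α → ℝ≥0∞) : Module.End ℝ≥0∞ (α → ℝ≥0∞) where
  toFun f z := ∑' w, p z w * f w
  map_add' f g := by
    funext z
    simp only [Pi.add_apply, mul_add, ENNReal.tsum_add]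
  map_smul' c f := by
    funext z
    simp only [Pi.smul_apply, smul_eq_mul, RingHom.id_apply, ← ENNReal.tsum_mul_left]
    exact tsum_congr fun w => by ring

lemma op_apply (p : α → α → ℝ≥0∞) (f : α → ℝ≥0∞) (z : α) :
    op p f z = ∑' w, p z w * f w := rfl

lemma op_mono (p : α → α → ℝ≥0∞) {f g : α → ℝ≥0∞} (h : f ≤ g) : op p f ≤ op p g := fun z =>
  ENNReal.tsum_le_tsum fun w => by gcongr; exact h w

lemma op_pow_apply (p : α → α → ℝ≥0∞) (n : ℕ) (f : α → ℝ≥0∞) (z : α) :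
    (op p ^ n) f z = ∑' w, nStep p n z w * f w := by
  induction n generalizing z with
  | zero =>
    rw [tsum_eq_single z]
    · simp [nStep]
    · intro w hw
      simp [nStep, hw]
  | succ n ih =>
    rw [pow_succ', Module.End.mul_apply, op_apply]
    simp only [ih, nStep, ← ENNReal.tsum_mul_left, ← ENNReal.tsum_mul_right]
    rw [ENNReal.tsum_comm]
    exact tsum_congr fun w => tsum_congr fun v => by ring

lemma op_nStep (p : α → α → ℝ≥0∞) (n : ℕ) : op (nStep p n) = op p ^ n := by
  ext f z
  rw [op_pow_apply, op_apply]

lemma op_pow_mono (p : α → α → ℝ≥0∞) (n : ℕ) {f g : α → ℝ≥0∞} (h : f ≤ g) :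
    (op p ^ n) f ≤ (op p ^ n) g := by
  rw [← op_nStep]
  exact op_mono _ h

open Classical in
lemma nStep_eq_op_pow (p : α → α → ℝ≥0∞) (n : ℕ) (z z' : α) :
    nStep p n z z' = (op p ^ n) (Pi.single z' 1) z := by
  rw [op_pow_apply, tsum_eq_single z']
  · simp
  · intro w hw
    simp [hw]

lemma nStep_add (p : α → α → ℝ≥0∞) (m n : ℕ) (z z' : α) :
    nStep p (m + n) z z' = ∑' w, nStep p m z w * nStep p n w z' := by
  classical
  rw [nStep_eq_op_pow, pow_add, Module.End.mul_apply, op_pow_apply]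
  simp only [← nStep_eq_op_pow]

lemma tsum_nStep_mul_green_le (p : α → α → ℝ≥0∞) (n : ℕ) (z w : α) :
    ∑' z', nStep p n z z' * green p z' w ≤ green p z w := by
  simp only [green, ← ENNReal.tsum_mul_left]
  rw [ENNReal.tsum_comm]
  simp only [← nStep_add]
  exact ENNReal.tsum_comp_le_tsum_of_injective (add_right_injective n) fun k => nStep p k z w

lemma nStep_mul_green_le (p : α → α → ℝ≥0∞) (n : ℕ) (z z' w : α) :
    nStep p n z z' * green p z' w ≤ green p z w :=
  (ENNReal.le_tsum z').trans (tsum_nStep_mul_green_le p n z w)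

lemma one_le_green_self (p : α → α → ℝ≥0∞) (z : α) : 1 ≤ green p z z := by
  refine le_trans ?_ (ENNReal.le_tsum 0)
  simp [nStep]

/-- Eigenfunction bounds from above pass to powers. -/
lemma pow_apply_le_of_apply_le {A : Module.End ℝ≥0∞ (α → ℝ≥0∞)}
    (hA : ∀ f g, f ≤ g → A f ≤ A g) {r : ℝ≥0∞} {e : α → ℝ≥0∞} (h : A e ≤ r • e) (n : ℕ) :
    (A ^ n) e ≤ r ^ n • e := by
  induction n with
  | zero => simp
  | succ n ih =>
    rw [pow_succ', Module.End.mul_apply]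
    refine (hA _ _ ih).trans ?_
    rw [map_smul, pow_succ, mul_smul]
    intro z
    simp only [Pi.smul_apply]
    gcongr
    exact h z

/-- Eigenfunction bounds from below pass to powers. -/
lemma le_pow_apply_of_le_apply {A : Module.End ℝ≥0∞ (α → ℝ≥0∞)}
    (hA : ∀ f g, f ≤ g → A f ≤ A g) {r : ℝ≥0∞} {e : α → ℝ≥0∞} (h : r • e ≤ A e) (n : ℕ) :
    r ^ n • e ≤ (A ^ n) e := by
  induction n with
  | zero => simp
  | succ n ih =>
    rw [pow_succ' A, Module.End.mul_apply]
    refine le_trans ?_ (hA _ _ ih)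
    rw [map_smul, pow_succ, mul_smul]
    intro z
    simp only [Pi.smul_apply]
    gcongr
    exact h z

lemma nStep_le_of_le (e : α ≃ β) {p : α → α → ℝ≥0∞} {q : β → β → ℝ≥0∞}
    (h : ∀ z z', p z z' ≤ q (e z) (e z')) (n : ℕ) (z z' : α) :
    nStep p n z z' ≤ nStep q n (e z) (e z') := by
  induction n generalizing z with
  | zero => by_cases hz : z' = z <;> simp [nStep, hz]
  | succ n ih =>
    simp only [nStep]
    rw [← e.tsum_eq]
    exact ENNReal.tsum_le_tsum fun w => mul_le_mul' (h z w) (ih w)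

end Operator

/-! ### Comparison of binomial expansions -/

section Binomial

variable {α : Type*} {T Q : Module.End ℝ≥0∞ (α → ℝ≥0∞)}

lemma smul_add_pow_apply (hTQ : Commute T Q) (ε : ℝ≥0∞) (n : ℕ) (f : α → ℝ≥0∞) (z : α) :
    ((ε • T + Q) ^ n) f z =
      ∑ k ∈ Finset.range (n + 1), (n.choose k : ℝ≥0∞) * ε ^ k * (T ^ k * Q ^ (n - k)) f z := by
  rw [(hTQ.smul_left ε).add_pow, LinearMap.sum_apply, Finset.sum_apply]
  refine Finset.sum_congr rfl fun k _ => ?_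
  rw [smul_pow, smul_mul_assoc, ← nsmul_eq_mul', LinearMap.smul_apply, LinearMap.smul_apply]
  simp only [Pi.smul_apply, smul_eq_mul, nsmul_eq_mul]
  ring

lemma apply_smul_add_pow_apply (hTQ : Commute T Q) (ε : ℝ≥0∞) (n : ℕ) (f : α → ℝ≥0∞) (z : α) :
    (T * (ε • T + Q) ^ n) f z =
      ∑ k ∈ Finset.range (n + 1),
        (n.choose k : ℝ≥0∞) * ε ^ k * (T ^ (k + 1) * Q ^ (n - k)) f z := by
  rw [(hTQ.smul_left ε).add_pow, Finset.mul_sum, LinearMap.sum_apply, Finset.sum_apply]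
  refine Finset.sum_congr rfl fun k _ => ?_
  rw [smul_pow, smul_mul_assoc, ← nsmul_eq_mul', mul_smul_comm, mul_smul_comm, ← mul_assoc,
    ← pow_succ', LinearMap.smul_apply, LinearMap.smul_apply]
  simp only [Pi.smul_apply, smul_eq_mul, nsmul_eq_mul]
  ring

/-- Among the `n + 1` factors of `(ε T + Q) ^ (n + 1)` the number `k` of factors `ε T` is
typically `ε (n + 1)`, and forgetting one of them multiplies a term by `k / (ε (n + 1))`. So
`T (ε T + Q) ^ n` is at most `(1 + σ) (ε T + Q) ^ (n + 1)`, up to the terms with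
`k > (1 + σ) ε (n + 1)`, which the weight `ρ ^ k c ^ (n + 1)` dominates. -/
lemma shift_pow_le (hTQ : Commute T Q) {ε ρ c σ : ℝ} (hε : 0 < ε) (hρ : 0 ≤ ρ) (hc : 0 ≤ c)
    (hσ : 0 < σ) (hw : ∀ k N : ℕ, (1 + σ) * ε * N ≤ k → 1 ≤ ρ ^ k * c ^ N) (n : ℕ)
    (f : α → ℝ≥0∞) (z : α) :
    (T * (ENNReal.ofReal ε • T + Q) ^ n) f z ≤
      ENNReal.ofReal (1 + σ) * ((ENNReal.ofReal ε • T + Q) ^ (n + 1)) f z +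
      ENNReal.ofReal (ε⁻¹ * c ^ (n + 1)) *
        ((ENNReal.ofReal (ρ * ε) • T + Q) ^ (n + 1)) f z := by
  rw [apply_smul_add_pow_apply hTQ, smul_add_pow_apply hTQ, smul_add_pow_apply hTQ,
    Finset.mul_sum, Finset.mul_sum, ← Finset.sum_add_distrib, Finset.sum_range_succ' _ (n + 1)]
  refine le_add_right (Finset.sum_le_sum fun j hj => ?_)
  rw [Nat.add_sub_add_right]
  generalize (T ^ (j + 1) * Q ^ (n - j)) f z = x
  rw [← mul_assoc _ _ x, ← mul_assoc _ _ x, ← add_mul]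
  gcongr
  rw [← ENNReal.ofReal_pow hε.le, ← ENNReal.ofReal_pow hε.le,
    ← ENNReal.ofReal_pow (mul_nonneg hρ hε.le), ← ENNReal.ofReal_natCast,
    ← ENNReal.ofReal_natCast, ← ENNReal.ofReal_mul (by positivity),
    ← ENNReal.ofReal_mul (by positivity), ← ENNReal.ofReal_mul (by positivity),
    ← ENNReal.ofReal_mul (by positivity), ← ENNReal.ofReal_mul (by positivity),
    ← ENNReal.ofReal_add (by positivity) (by positivity)]
  apply ENNReal.ofReal_le_ofReal
  have hjn : j + 1 ≤ n + 1 := by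
    have := Finset.mem_range.1 hj
    omega
  have hid : ((n + 1 : ℕ) : ℝ) * (n.choose j : ℝ) =
      ((n + 1).choose (j + 1) : ℝ) * ((j + 1 : ℕ) : ℝ) := by
    exact_mod_cast Nat.add_one_mul_choose_eq n j
  set B : ℝ := ((n + 1).choose (j + 1) : ℝ)
  have hB : 0 ≤ B := by positivity
  have hN : (0 : ℝ) < ((n + 1 : ℕ) : ℝ) := by positivity
  have hj' : ((j + 1 : ℕ) : ℝ) ≤ ((n + 1 : ℕ) : ℝ) := by exact_mod_cast hjn
  -- the ratio of the two coefficients is `(j + 1) / (ε (n + 1))`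
  have key : ((j + 1 : ℕ) : ℝ) ≤
      ((1 + σ) * ε + ρ ^ (j + 1) * c ^ (n + 1)) * ((n + 1 : ℕ) : ℝ) := by
    have h0 : 0 ≤ ρ ^ (j + 1) * c ^ (n + 1) := by positivity
    rcases le_total ((1 + σ) * ε * ((n + 1 : ℕ) : ℝ)) ((j + 1 : ℕ) : ℝ) with h | h
    · have := hw _ _ h
      have h1 : 0 ≤ (1 + σ) * ε := by positivity
      nlinarith
    · nlinarith
  have e1 : (n.choose j : ℝ) = B * ((j + 1 : ℕ) : ℝ) / ((n + 1 : ℕ) : ℝ) := by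
    rw [← hid]; field_simp
  have e2 : ((j + 1 : ℕ) : ℝ) / ((n + 1 : ℕ) : ℝ) ≤ (1 + σ) * ε + ρ ^ (j + 1) * c ^ (n + 1) := by
    rwa [div_le_iff₀ hN]
  calc (n.choose j : ℝ) * ε ^ j
      = B * ε ^ j * (((j + 1 : ℕ) : ℝ) / ((n + 1 : ℕ) : ℝ)) := by rw [e1]; ring
    _ ≤ B * ε ^ j * ((1 + σ) * ε + ρ ^ (j + 1) * c ^ (n + 1)) := by gcongr
    _ = _ := by
      rw [mul_pow, pow_succ ε]
      field_simp

/-- The reverse of `shift_pow_le`: the exceptional terms are those with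
`(1 + σ) k < ε (n + 1)`. -/
lemma pow_succ_le_shift_pow (hTQ : Commute T Q) {ε ρ c σ : ℝ} (hε : 0 < ε) (hρ : 0 ≤ ρ)
    (hc : 0 ≤ c) (hσ : 0 < σ) (hw : ∀ k N : ℕ, (1 + σ) * k ≤ ε * N → 1 ≤ ρ ^ k * c ^ N) (n : ℕ)
    (f : α → ℝ≥0∞) (z : α) :
    ((ENNReal.ofReal ε • T + Q) ^ (n + 1)) f z ≤
      ENNReal.ofReal (1 + σ) * (T * (ENNReal.ofReal ε • T + Q) ^ n) f z +
      ENNReal.ofReal (c ^ (n + 1)) *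
        ((ENNReal.ofReal (ρ * ε) • T + Q) ^ (n + 1)) f z := by
  rw [apply_smul_add_pow_apply hTQ, smul_add_pow_apply hTQ, smul_add_pow_apply hTQ,
    Finset.mul_sum, Finset.mul_sum, Finset.sum_range_succ' _ (n + 1),
    Finset.sum_range_succ' _ (n + 1), ← add_assoc, ← Finset.sum_add_distrib]
  refine add_le_add (Finset.sum_le_sum fun j hj => ?_) ?_
  · rw [Nat.add_sub_add_right]
    generalize (T ^ (j + 1) * Q ^ (n - j)) f z = x
    rw [← mul_assoc _ _ x, ← mul_assoc _ _ x, ← add_mul]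
    gcongr
    rw [← ENNReal.ofReal_pow hε.le, ← ENNReal.ofReal_pow hε.le,
      ← ENNReal.ofReal_pow (mul_nonneg hρ hε.le), ← ENNReal.ofReal_natCast,
      ← ENNReal.ofReal_natCast, ← ENNReal.ofReal_mul (by positivity),
      ← ENNReal.ofReal_mul (by positivity), ← ENNReal.ofReal_mul (by positivity),
      ← ENNReal.ofReal_mul (by positivity), ← ENNReal.ofReal_mul (by positivity),
      ← ENNReal.ofReal_add (by positivity) (by positivity)]
    apply ENNReal.ofReal_le_ofReal
    have hid : ((n + 1 : ℕ) : ℝ) * (n.choose j : ℝ) =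
        ((n + 1).choose (j + 1) : ℝ) * ((j + 1 : ℕ) : ℝ) := by
      exact_mod_cast Nat.add_one_mul_choose_eq n j
    set B : ℝ := ((n + 1).choose (j + 1) : ℝ)
    have hB : 0 ≤ B := by positivity
    have hN : (0 : ℝ) < ((n + 1 : ℕ) : ℝ) := by positivity
    have key : ε * ((n + 1 : ℕ) : ℝ) ≤ (1 + σ) * ((j + 1 : ℕ) : ℝ) +
        ρ ^ (j + 1) * c ^ (n + 1) * (ε * ((n + 1 : ℕ) : ℝ)) := by
      have h0 : 0 ≤ ρ ^ (j + 1) * c ^ (n + 1) := by positivity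
      have h1 : 0 ≤ ε * ((n + 1 : ℕ) : ℝ) := by positivity
      rcases le_total ((1 + σ) * ((j + 1 : ℕ) : ℝ)) (ε * ((n + 1 : ℕ) : ℝ)) with h | h
      · have := hw _ _ h
        have h2 : 0 ≤ (1 + σ) * ((j + 1 : ℕ) : ℝ) := by positivity
        nlinarith
      · nlinarith [mul_nonneg h0 h1]
    have e1 : (n.choose j : ℝ) = B * ((j + 1 : ℕ) : ℝ) / ((n + 1 : ℕ) : ℝ) := by
      rw [← hid]; field_simp
    have e2 : ε ≤ (1 + σ) * (((j + 1 : ℕ) : ℝ) / ((n + 1 : ℕ) : ℝ)) +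
        ρ ^ (j + 1) * c ^ (n + 1) * ε := by
      rw [← mul_le_mul_iff_of_pos_right hN]
      refine key.trans (le_of_eq ?_)
      field_simp
    calc B * ε ^ (j + 1) = B * ε ^ j * ε := by ring
      _ ≤ B * ε ^ j * ((1 + σ) * (((j + 1 : ℕ) : ℝ) / ((n + 1 : ℕ) : ℝ)) +
        ρ ^ (j + 1) * c ^ (n + 1) * ε) := by gcongr
      _ = _ := by rw [e1, mul_pow, pow_succ ε]; ring
  · have := hw 0 (n + 1) (by simp; positivity)
    rw [pow_zero, one_mul] at this
    simp only [pow_zero, mul_one]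
    exact le_mul_of_one_le_left' (by simpa using ENNReal.ofReal_le_ofReal this)

end Binomial


/-! ### Exponential weights and the killed walk -/

/-- The exponential weight `z ↦ exp(s z₁ + t z₂)`, with values in `[0, ∞]`. -/
def expW (s t : ℝ) (z : ℤ × ℤ) : ℝ≥0∞ := ENNReal.ofReal (Real.exp (s * z.1 + t * z.2))

/-- The jump generating function `∑ z, ν(z) exp(s z₁ + t z₂)`, with values in `[0, ∞]`. -/
def genFun (ν : PMF (ℤ × ℤ)) (s t : ℝ) : ℝ≥0∞ := ∑' z, ν z * expW s t z

lemma expW_add (s t : ℝ) (z z' : ℤ × ℤ) : expW s t (z + z') = expW s t z * expW s t z' := by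
  rw [expW, expW, expW, ← ENNReal.ofReal_mul (Real.exp_nonneg _), ← Real.exp_add]
  congr 2
  push_cast [Prod.fst_add, Prod.snd_add]
  ring

lemma expW_mul_expW (s t s' t' : ℝ) (z : ℤ × ℤ) :
    expW s t z * expW s' t' z = expW (s + s') (t + t') z := by
  rw [expW, expW, expW, ← ENNReal.ofReal_mul (Real.exp_nonneg _), ← Real.exp_add]
  congr 2
  ring

lemma expW_zero_zero (z : ℤ × ℤ) : expW 0 0 z = 1 := by simp [expW]

lemma expW_ne_top (s t : ℝ) (z : ℤ × ℤ) : expW s t z ≠ ⊤ := ENNReal.ofReal_ne_top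

lemma expW_ne_zero (s t : ℝ) (z : ℤ × ℤ) : expW s t z ≠ 0 := by
  simp [expW, Real.exp_pos]

lemma killedKernel_le {A : Type*} [AddCommGroup A] (ν : PMF A) (E : Set A) (z z' : A) :
    killedKernel ν E z z' ≤ ν (z' - z) := by
  unfold killedKernel
  split_ifs <;> simp

lemma killedKernel_mono {A : Type*} [AddCommGroup A] (ν : PMF A) {E E' : Set A} {z z' y y' : A}
    (h : z ∈ E → y ∈ E') (h' : z' ∈ E → y' ∈ E') (hsub : z' - z = y' - y) :
    killedKernel ν E z z' ≤ killedKernel ν E' y y' := by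
  unfold killedKernel
  by_cases hz : z ∈ E ∧ z' ∈ E
  · rw [if_pos hz, if_pos ⟨h hz.1, h' hz.2⟩, hsub]
  · rw [if_neg hz]
    exact zero_le

lemma op_killedKernel_expW_le (ν : PMF (ℤ × ℤ)) (E : Set (ℤ × ℤ)) (s t : ℝ) :
    op (killedKernel ν E) (expW s t) ≤ genFun ν s t • expW s t := by
  intro z
  rw [op_apply, Pi.smul_apply, smul_eq_mul, genFun, ← ENNReal.tsum_mul_right]
  rw [← (Equiv.addRight z).tsum_eq]
  refine ENNReal.tsum_le_tsum fun v => ?_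
  rw [Equiv.coe_addRight, expW_add, mul_assoc]
  gcongr
  simpa using killedKernel_le ν E z (v + z)

lemma tsum_nStep_mul_expW_le (ν : PMF (ℤ × ℤ)) (E : Set (ℤ × ℤ)) (s t : ℝ) (n : ℕ)
    (z : ℤ × ℤ) :
    ∑' w, nStep (killedKernel ν E) n z w * expW s t w ≤ genFun ν s t ^ n * expW s t z := by
  rw [← op_pow_apply]
  exact pow_apply_le_of_apply_le (fun _ _ => op_mono _) (op_killedKernel_expW_le ν E s t) n z

lemma nStep_mul_expW_le (ν : PMF (ℤ × ℤ)) (E : Set (ℤ × ℤ)) (s t : ℝ) (n : ℕ)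
    (z w : ℤ × ℤ) :
    nStep (killedKernel ν E) n z w * expW s t w ≤ genFun ν s t ^ n * expW s t z :=
  (ENNReal.le_tsum w).trans (tsum_nStep_mul_expW_le ν E s t n z)

lemma genFun_zero_zero (ν : PMF (ℤ × ℤ)) : genFun ν 0 0 = 1 := by
  simp [genFun, expW_zero_zero, ν.tsum_coe]

lemma nStep_killedKernel_le_translate (ν : PMF (ℤ × ℤ)) {v : ℤ × ℤ} (hv : 0 ≤ v.2) (n : ℕ)
    (z z' : ℤ × ℤ) :
    nStep (killedKernel ν halfPlane) n z z' ≤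
      nStep (killedKernel ν halfPlane) n (z + v) (z' + v) := by
  refine nStep_le_of_le (Equiv.addRight v) (fun z z' => ?_) n z z'
  exact killedKernel_mono ν (fun h => lt_of_lt_of_le h (le_add_of_nonneg_right hv))
    (fun h => lt_of_lt_of_le h (le_add_of_nonneg_right hv)) (by simp)

lemma nStep_killedKernel_translate (ν : PMF (ℤ × ℤ)) {v : ℤ × ℤ} (hv : v.2 = 0) (n : ℕ)
    (z z' : ℤ × ℤ) :
    nStep (killedKernel ν halfPlane) n (z + v) (z' + v) =
      nStep (killedKernel ν halfPlane) n z z' := by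
  refine le_antisymm ?_ (nStep_killedKernel_le_translate ν hv.ge n z z')
  simpa using nStep_killedKernel_le_translate ν (v := -v) (by simp [hv]) n (z + v) (z' + v)

lemma nStep_killedKernel_eq_zero {ν : PMF (ℤ × ℤ)} {n : ℕ} (hn : n ≠ 0) {z z' : ℤ × ℤ}
    (h : ¬(z ∈ halfPlane ∧ z' ∈ halfPlane)) : nStep (killedKernel ν halfPlane) n z z' = 0 := by
  induction n generalizing z with
  | zero => exact absurd rfl hn
  | succ n ih =>
    simp only [nStep, ENNReal.tsum_eq_zero, mul_eq_zero]
    intro w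
    by_cases hw : z ∈ halfPlane ∧ w ∈ halfPlane
    · right
      rcases n with _ | n
      · have : z' ≠ w := by rintro rfl; exact h hw
        simp [nStep, this]
      · exact ih (by simp) fun h' => h ⟨hw.1, h'.2⟩
    · left
      simp [killedKernel, hw]

/-- The walk of jump law `ν` after the exponential change of measure: its drift is `(c, 0)` with
`c > 0`, as recorded by the second order upper bound on the generating function near `0`; it has
a nondegenerate centred vertical component, as recorded by `one_lt_genFun`; and the walk killed
outside the quadrant is irreducible. -/
structure HorizontalDrift (ν : PMF (ℤ × ℤ)) (c C : ℝ) : Prop where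
  c_pos : 0 < c
  C_nonneg : 0 ≤ C
  genFun_le : ∀ s t : ℝ, |s| ≤ 1 → |t| ≤ 1 →
    genFun ν s t ≤ ENNReal.ofReal (1 + c * s + C * (s ^ 2 + t ^ 2))
  one_lt_genFun : ∀ t : ℝ, 0 < t → 1 < genFun ν 0 t
  irreducible : IrreducibleOn (killedKernel ν quadrant) quadrant

/-! ### Harnack inequality -/

/-- A path of the quadrant can be followed from every point of the half-plane. -/
lemma exists_le_nStep {ν : PMF (ℤ × ℤ)}
    (h : IrreducibleOn (killedKernel ν quadrant) quadrant) {d d' : ℤ × ℤ}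
    (hd : 0 ≤ d.1 ∧ 0 ≤ d.2) (hd' : 0 ≤ d'.1 ∧ 0 ≤ d'.2) :
    ∃ n : ℕ, ∃ η : ℝ≥0∞, η ≠ 0 ∧ ∀ z ∈ halfPlane,
      η ≤ nStep (killedKernel ν halfPlane) n (z + d) (z + d') := by
  obtain ⟨n, hn⟩ := h (d + (1, 1)) (by constructor <;> simp <;> omega) (d' + (1, 1))
    (by constructor <;> simp <;> omega)
  refine ⟨n, _, hn.ne', fun z hz => ?_⟩
  have h1 : nStep (killedKernel ν quadrant) n (d + (1, 1)) (d' + (1, 1)) ≤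
      nStep (killedKernel ν halfPlane) n (d + (1, 1)) (d' + (1, 1)) := by
    refine nStep_le_of_le (Equiv.refl _) (fun z z' => ?_) n _ _
    exact killedKernel_mono ν And.right And.right rfl
  have h2 := nStep_killedKernel_le_translate ν (v := z - (1, 1))
    (Int.sub_nonneg_of_le hz) n (d + (1, 1)) (d' + (1, 1))
  refine (h1.trans h2).trans (le_of_eq ?_)
  congr 1 <;> abel

lemma exists_green_le {ν : PMF (ℤ × ℤ)}
    (h : IrreducibleOn (killedKernel ν quadrant) quadrant) {d d' : ℤ × ℤ}
    (hd : 0 ≤ d.1 ∧ 0 ≤ d.2) (hd' : 0 ≤ d'.1 ∧ 0 ≤ d'.2) :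
    ∃ K : ℝ, ∀ z ∈ halfPlane, ∀ w,
      greenHalfPlane ν (z + d') w ≤ ENNReal.ofReal (Real.exp K) * greenHalfPlane ν (z + d) w := by
  obtain ⟨n, η, hη, hn⟩ := exists_le_nStep h hd hd'
  have hη' : η⁻¹ ≠ ⊤ := by simpa using hη
  refine ⟨η⁻¹.toReal, fun z hz w => ?_⟩
  have h1 : η⁻¹ ≤ ENNReal.ofReal (Real.exp η⁻¹.toReal) := by
    rw [← ENNReal.ofReal_toReal hη']
    refine ENNReal.ofReal_le_ofReal ?_
    rw [ENNReal.toReal_ofReal ENNReal.toReal_nonneg]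
    linarith [Real.add_one_le_exp η⁻¹.toReal]
  have h2 : η * greenHalfPlane ν (z + d') w ≤ greenHalfPlane ν (z + d) w :=
    (mul_le_mul_left (hn z hz) _).trans (nStep_mul_green_le _ n _ _ w)
  by_cases ht : η = ⊤
  · subst ht
    by_cases h0 : greenHalfPlane ν (z + d') w = 0
    · simp [h0]
    · rw [ENNReal.top_mul h0, top_le_iff] at h2
      rw [h2, ENNReal.mul_top (by simp)]
      exact le_top
  · calc greenHalfPlane ν (z + d') w = η⁻¹ * (η * greenHalfPlane ν (z + d') w) := by
          rw [← mul_assoc, ENNReal.inv_mul_cancel hη ht, one_mul]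
      _ ≤ _ := mul_le_mul' h1 h2

/-- Bounds between neighbours propagate along a line of lattice points. -/
lemma le_exp_mul_of_step {g : ℕ → ℝ≥0∞} {K : ℝ} {N : ℕ}
    (h : ∀ k < N, g (k + 1) ≤ ENNReal.ofReal (Real.exp K) * g k) :
    g N ≤ ENNReal.ofReal (Real.exp (K * N)) * g 0 := by
  induction N with
  | zero => simp
  | succ N ih =>
    refine (h N (by simp)).trans ?_
    refine (mul_le_mul_right (ih fun k hk => h k (by omega)) _).trans (le_of_eq ?_)
    rw [← mul_assoc, ← ENNReal.ofReal_mul (Real.exp_nonneg _), ← Real.exp_add]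
    push_cast
    ring_nf

lemma harnack {ν : PMF (ℤ × ℤ)}
    (h : IrreducibleOn (killedKernel ν quadrant) quadrant) :
    ∃ K : ℝ, 0 ≤ K ∧ ∀ z ∈ halfPlane, ∀ z' ∈ halfPlane, ∀ w,
      greenHalfPlane ν z' w ≤
        ENNReal.ofReal (Real.exp (K * (|(z'.1 : ℝ) - z.1| + |(z'.2 : ℝ) - z.2|))) *
          greenHalfPlane ν z w := by
  obtain ⟨K₁, h₁⟩ := exists_green_le h (d := (0, 0)) (d' := (1, 0)) (by simp) (by simp)
  obtain ⟨K₂, h₂⟩ := exists_green_le h (d := (1, 0)) (d' := (0, 0)) (by simp) (by simp)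
  obtain ⟨K₃, h₃⟩ := exists_green_le h (d := (0, 0)) (d' := (0, 1)) (by simp) (by simp)
  obtain ⟨K₄, h₄⟩ := exists_green_le h (d := (0, 1)) (d' := (0, 0)) (by simp) (by simp)
  set K := max (max K₁ K₂) (max (max K₃ K₄) 0) with hK
  have hmono : ∀ {L : ℝ}, L ≤ K → ENNReal.ofReal (Real.exp L) ≤ ENNReal.ofReal (Real.exp K) :=
    fun hL => ENNReal.ofReal_le_ofReal (Real.exp_le_exp.2 hL)
  have e₁ := hmono (L := K₁) (by simp [hK])
  have e₂ := hmono (L := K₂) (by simp [hK])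
  have e₃ := hmono (L := K₃) (by simp [hK])
  have e₄ := hmono (L := K₄) (by simp [hK])
  refine ⟨K, by simp [hK], fun z hz z' hz' w => ?_⟩
  -- first along the horizontal line of `z`, then along the vertical line of `z'`
  have hor : ∀ z ∈ halfPlane, ∀ x : ℤ, greenHalfPlane ν (x, z.2) w ≤
      ENNReal.ofReal (Real.exp (K * |(x : ℝ) - z.1|)) * greenHalfPlane ν z w := by
    intro z hz x
    have hm : ∀ x : ℤ, (x, z.2) ∈ halfPlane := fun x => hz
    rcases le_total z.1 x with hx | hx
    · obtain ⟨N, hN⟩ := Int.eq_ofNat_of_zero_le (sub_nonneg.2 hx)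
      have key := le_exp_mul_of_step (g := fun k : ℕ => greenHalfPlane ν (z.1 + k, z.2) w) (K := K)
        (N := N) fun k _ => by
          refine le_trans ?_ (mul_le_mul_left e₁ _)
          simpa [add_assoc] using h₁ _ (hm (z.1 + k)) w
      have hx' : x = z.1 + N := by omega
      subst hx'
      simpa using key
    · obtain ⟨N, hN⟩ := Int.eq_ofNat_of_zero_le (sub_nonneg.2 hx)
      have key := le_exp_mul_of_step (g := fun k : ℕ => greenHalfPlane ν (z.1 - k, z.2) w) (K := K)
        (N := N) fun k _ => by
          refine le_trans ?_ (mul_le_mul_left e₂ _)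
          have := h₂ _ (hm (z.1 - (k + 1 : ℕ))) w
          rw [show ((z.1 - (k + 1 : ℕ), z.2) : ℤ × ℤ) + (1, 0) = (z.1 - k, z.2) by
            refine Prod.ext ?_ ?_ <;> (simp; try omega)] at this
          simpa using this
      have hx' : x = z.1 - N := by omega
      subst hx'
      simpa using key
  have ver : ∀ z ∈ halfPlane, ∀ y : ℤ, 0 < y → greenHalfPlane ν (z.1, y) w ≤
      ENNReal.ofReal (Real.exp (K * |(y : ℝ) - z.2|)) * greenHalfPlane ν z w := by
    intro z hz y hy
    have hz0 : 0 < z.2 := hz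
    rcases le_total z.2 y with hx | hx
    · obtain ⟨N, hN⟩ := Int.eq_ofNat_of_zero_le (sub_nonneg.2 hx)
      have key := le_exp_mul_of_step (g := fun k : ℕ => greenHalfPlane ν (z.1, z.2 + k) w) (K := K)
        (N := N) fun k _ => by
          refine le_trans ?_ (mul_le_mul_left e₃ _)
          have := h₃ (z.1, z.2 + k) (by simp [halfPlane]; omega) w
          simpa [add_assoc] using this
      have hx' : y = z.2 + N := by omega
      subst hx'
      simpa using key
    · obtain ⟨N, hN⟩ := Int.eq_ofNat_of_zero_le (sub_nonneg.2 hx)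
      have key := le_exp_mul_of_step (g := fun k : ℕ => greenHalfPlane ν (z.1, z.2 - k) w) (K := K)
        (N := N) fun k hk => by
          refine le_trans ?_ (mul_le_mul_left e₄ _)
          have := h₄ (z.1, z.2 - (k + 1 : ℕ)) (by simp [halfPlane]; omega) w
          rw [show ((z.1, z.2 - (k + 1 : ℕ)) : ℤ × ℤ) + (0, 1) = (z.1, z.2 - k) by
            refine Prod.ext ?_ ?_ <;> (simp; try omega)] at this
          simpa using this
      have hx' : y = z.2 - N := by omega
      subst hx'
      simpa using key
  have s1 := hor z hz z'.1
  have s2 := ver (z'.1, z.2) hz z'.2 hz'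
  refine s2.trans ((mul_le_mul_right s1 _).trans (le_of_eq ?_))
  rw [← mul_assoc, ← ENNReal.ofReal_mul (Real.exp_nonneg _), ← Real.exp_add]
  ring_nf


/-! ### Horizontal ratios of the Green function -/

open Classical in
/-- The translation `f ↦ f(· + (1, 0))` on functions on the half-plane (extended by zero). -/
def shift : Module.End ℝ≥0∞ (ℤ × ℤ → ℝ≥0∞) where
  toFun f z := if z ∈ halfPlane then f (z + (1, 0)) else 0
  map_add' f g := by
    funext z
    by_cases h : z ∈ halfPlane <;> simp [h]
  map_smul' c f := by
    funext z
    by_cases h : z ∈ halfPlane <;> simp [h]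

lemma shift_apply {f : ℤ × ℤ → ℝ≥0∞} {z : ℤ × ℤ} (hz : z ∈ halfPlane) :
    shift f z = f (z + (1, 0)) := if_pos hz

lemma shift_apply_of_notMem {f : ℤ × ℤ → ℝ≥0∞} {z : ℤ × ℤ} (hz : z ∉ halfPlane) :
    shift f z = 0 := if_neg hz

lemma add_one_zero_mem_halfPlane {z : ℤ × ℤ} : z + (1, 0) ∈ halfPlane ↔ z ∈ halfPlane := by
  simp [halfPlane]

lemma shift_mono {f g : ℤ × ℤ → ℝ≥0∞} (h : f ≤ g) : shift f ≤ shift g := by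
  intro z
  by_cases hz : z ∈ halfPlane
  · rw [shift_apply hz, shift_apply hz]
    exact h _
  · rw [shift_apply_of_notMem hz]
    exact zero_le

lemma commute_shift_op {q : ℤ × ℤ → ℤ × ℤ → ℝ≥0∞}
    (hq : ∀ z w, q (z + (1, 0)) (w + (1, 0)) = q z w)
    (h0 : ∀ z w, ¬(z ∈ halfPlane ∧ w ∈ halfPlane) → q z w = 0) : Commute shift (op q) := by
  ext f z
  rw [Module.End.mul_apply, Module.End.mul_apply, op_apply]
  by_cases hz : z ∈ halfPlane
  · rw [shift_apply hz, op_apply, ← (Equiv.addRight ((1 : ℤ), (0 : ℤ))).tsum_eq]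
    refine tsum_congr fun w => ?_
    rw [Equiv.coe_addRight, hq]
    by_cases hw : w ∈ halfPlane
    · rw [shift_apply hw]
    · rw [h0 z w (by tauto)]
      simp
  · rw [shift_apply_of_notMem hz]
    symm
    rw [ENNReal.tsum_eq_zero]
    intro w
    rw [h0 z w (by tauto), zero_mul]

/-- A power of the killed walk splits as `ε` times the shift plus a kernel that commutes with the
shift. -/
lemma exists_op_pow_eq_smul_shift_add {ν : PMF (ℤ × ℤ)} {m : ℕ} (hm : m ≠ 0) {ε : ℝ≥0∞}
    (hε : ∀ z ∈ halfPlane, ε ≤ nStep (killedKernel ν halfPlane) m z (z + (1, 0))) :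
    ∃ q, Commute shift (op q) ∧ op (killedKernel ν halfPlane) ^ m = ε • shift + op q := by
  classical
  set r : ℤ × ℤ → ℤ × ℤ → ℝ≥0∞ := fun z w => if z ∈ halfPlane ∧ w = z + (1, 0) then ε else 0
    with hr
  have hle : ∀ z w, r z w ≤ nStep (killedKernel ν halfPlane) m z w := by
    intro z w
    simp only [hr]
    split_ifs with h
    · rw [h.2]
      exact hε z h.1
    · exact zero_le
  refine ⟨fun z w => nStep (killedKernel ν halfPlane) m z w - r z w,
    commute_shift_op (fun z w => ?_) (fun z w h => ?_), ?_⟩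
  · rw [nStep_killedKernel_translate ν rfl]
    congr 1
    simp only [hr, add_one_zero_mem_halfPlane, add_left_inj]
  · rw [nStep_killedKernel_eq_zero hm h, zero_tsub]
  · ext f z
    rw [← op_nStep, op_apply, LinearMap.add_apply, LinearMap.smul_apply, Pi.add_apply,
      Pi.smul_apply, smul_eq_mul, op_apply]
    have h1 : ε * shift f z = ∑' w, r z w * f w := by
      by_cases hz : z ∈ halfPlane
      · rw [shift_apply hz, tsum_eq_single (z + (1, 0))]
        · simp [hr, hz]
        · intro w hw
          simp [hr, hw]
      · rw [shift_apply_of_notMem hz]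
        simp [hr, hz]
    rw [h1, ← ENNReal.tsum_add]
    refine tsum_congr fun w => ?_
    rw [← add_mul, add_tsub_cancel_of_le (hle z w)]

lemma apply_eq_zero_of_notMem {q : ℤ × ℤ → ℤ × ℤ → ℝ≥0∞} {ν : PMF (ℤ × ℤ)} {m : ℕ} (hm : m ≠ 0)
    {ε : ℝ≥0∞} (hX : op (killedKernel ν halfPlane) ^ m = ε • shift + op q)
    {f : ℤ × ℤ → ℝ≥0∞} {z : ℤ × ℤ} (hz : z ∉ halfPlane) : op q f z = 0 := by
  have h := congrFun (congrArg (fun A => A f) hX) z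
  simp only [← op_nStep] at h
  rw [op_apply, LinearMap.add_apply, Pi.add_apply] at h
  have h0 : ∑' w, nStep (killedKernel ν halfPlane) m z w * f w = 0 := by
    rw [ENNReal.tsum_eq_zero]
    intro w
    rw [nStep_killedKernel_eq_zero hm (by tauto), zero_mul]
  rw [h0] at h
  exact (add_eq_zero.1 h.symm).2

/-- Changing the weight of the shift from `ε` to `ρ ε` changes the norm on the weight
`exp(b z₁)` from that of the killed walk by `(ρ - 1) ε exp(b)`. -/
lemma smul_shift_add_expW_le {q : ℤ × ℤ → ℤ × ℤ → ℝ≥0∞} {ν : PMF (ℤ × ℤ)} {m : ℕ} (hm : m ≠ 0)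
    {ε ε' R : ℝ≥0∞} (hε : ε ≠ ⊤) {b : ℝ}
    (hX : op (killedKernel ν halfPlane) ^ m = ε • shift + op q)
    (hR : genFun ν b 0 ^ m + ε' * ENNReal.ofReal (Real.exp b) ≤
      R + ε * ENNReal.ofReal (Real.exp b)) :
    (ε' • shift + op q) (expW b 0) ≤ R • expW b 0 := by
  intro z
  rw [LinearMap.add_apply, Pi.add_apply, LinearMap.smul_apply, Pi.smul_apply, Pi.smul_apply,
    smul_eq_mul, smul_eq_mul]
  by_cases hz : z ∈ halfPlane
  · have e1 : shift (expW b 0) z = ENNReal.ofReal (Real.exp b) * expW b 0 z := by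
      rw [shift_apply hz, expW_add, mul_comm]
      simp [expW]
    have e2 : ε * shift (expW b 0) z + op q (expW b 0) z ≤ genFun ν b 0 ^ m * expW b 0 z := by
      have h := pow_apply_le_of_apply_le (fun _ _ => op_mono _)
        (op_killedKernel_expW_le ν halfPlane b 0) m z
      rw [hX] at h
      exact h
    have hfin : ε * (ENNReal.ofReal (Real.exp b) * expW b 0 z) ≠ ⊤ :=
      ENNReal.mul_ne_top hε (ENNReal.mul_ne_top ENNReal.ofReal_ne_top (expW_ne_top _ _ _))
    rw [e1] at e2 ⊢
    refine (ENNReal.add_le_add_iff_right hfin).1 ?_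
    calc _ = ε' * (ENNReal.ofReal (Real.exp b) * expW b 0 z) +
          (ε * (ENNReal.ofReal (Real.exp b) * expW b 0 z) + op q (expW b 0) z) := by ring
      _ ≤ ε' * (ENNReal.ofReal (Real.exp b) * expW b 0 z) + genFun ν b 0 ^ m * expW b 0 z := by
          gcongr
      _ = (genFun ν b 0 ^ m + ε' * ENNReal.ofReal (Real.exp b)) * expW b 0 z := by ring
      _ ≤ (R + ε * ENNReal.ofReal (Real.exp b)) * expW b 0 z := by gcongr
      _ = _ := by ring
  · rw [shift_apply_of_notMem hz, apply_eq_zero_of_notMem hm hX hz]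
    simp

lemma smul_shift_add_mono (q : ℤ × ℤ → ℤ × ℤ → ℝ≥0∞) (ε : ℝ≥0∞) (f g : ℤ × ℤ → ℝ≥0∞)
    (h : f ≤ g) : (ε • shift + op q) f ≤ (ε • shift + op q) g := by
  intro z
  simp only [LinearMap.add_apply, Pi.add_apply, LinearMap.smul_apply, Pi.smul_apply, smul_eq_mul]
  gcongr
  · exact shift_mono h z
  · exact op_mono q h z

/-- If the exceptional terms have total weight less than one, then a small tilt `b > 0` in the
direction of the drift keeps it so. -/
lemma HorizontalDrift.exists_tilt {ν : PMF (ℤ × ℤ)} {c₀ C : ℝ} (h : HorizontalDrift ν c₀ C)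
    {ε ρ c : ℝ} (hρ : 0 ≤ ρ) (hε : 0 ≤ ε) (m : ℕ) (hc : c * (1 + (ρ - 1) * ε) < 1) :
    ∃ b : ℝ, 0 < b ∧ b ≤ 1 ∧ ∃ R : ℝ, c * R < 1 ∧
      genFun ν b 0 ^ m + ENNReal.ofReal (ρ * ε) * ENNReal.ofReal (Real.exp b) ≤
        ENNReal.ofReal R + ENNReal.ofReal ε * ENNReal.ofReal (Real.exp b) := by
  set F : ℝ → ℝ := fun b => (1 + c₀ * b + C * (b ^ 2 + 0 ^ 2)) ^ m + (ρ - 1) * ε * Real.exp b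
    with hF
  have hcont : Continuous F := by fun_prop
  have hF0 : c * F 0 < 1 := by simpa [hF] using hc
  have hev : ∀ᶠ b in 𝓝 (0 : ℝ), c * F b < 1 :=
    (continuous_const.mul hcont).continuousAt.eventually (gt_mem_nhds hF0)
  obtain ⟨δ, hδ, hδ'⟩ := Metric.eventually_nhds_iff.1 hev
  have hb0 : 0 < min (δ / 2) 1 := by positivity
  refine ⟨min (δ / 2) 1, hb0, min_le_right _ _, max (F (min (δ / 2) 1)) 0, ?_, ?_⟩
  · rcases le_total (F (min (δ / 2) 1)) 0 with h0 | h0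
    · rw [max_eq_right h0]; simp
    · rw [max_eq_left h0]
      apply hδ'
      rw [Real.dist_eq, sub_zero, abs_of_pos hb0]
      exact (min_le_left _ _).trans_lt (by linarith)
  · set b := min (δ / 2) 1
    have h1 := h.genFun_le b 0 (by rw [abs_of_pos hb0]; exact min_le_right _ _) (by simp)
    have hpos : 0 ≤ 1 + c₀ * b + C * (b ^ 2 + 0 ^ 2) := by
      have := h.c_pos
      have := h.C_nonneg
      positivity
    calc genFun ν b 0 ^ m + ENNReal.ofReal (ρ * ε) * ENNReal.ofReal (Real.exp b)
        ≤ ENNReal.ofReal (1 + c₀ * b + C * (b ^ 2 + 0 ^ 2)) ^ m +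
          ENNReal.ofReal (ρ * ε) * ENNReal.ofReal (Real.exp b) := by gcongr
      _ = ENNReal.ofReal (F b + ε * Real.exp b) := by
          rw [← ENNReal.ofReal_pow hpos, ← ENNReal.ofReal_mul (by positivity),
            ← ENNReal.ofReal_add (by positivity) (by positivity)]
          congr 1
          simp only [hF]
          ring
      _ ≤ ENNReal.ofReal (max (F b) 0 + ε * Real.exp b) := by
          apply ENNReal.ofReal_le_ofReal
          gcongr
          exact le_max_left _ _
      _ = _ := by
          rw [ENNReal.ofReal_add (le_max_right _ _) (by positivity), ENNReal.ofReal_mul hε]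

lemma expW_sub (b : ℝ) (z w : ℤ × ℤ) : expW b 0 (z - w) = expW (-b) 0 w * expW b 0 z := by
  simp only [expW]
  rw [← ENNReal.ofReal_mul (Real.exp_nonneg _), ← Real.exp_add]
  congr 2
  push_cast [Prod.fst_sub]
  ring

lemma single_le_expW (b : ℝ) (w : ℤ × ℤ) :
    (Set.indicator {w} 1 : ℤ × ℤ → ℝ≥0∞) ≤ expW (-b) 0 w • expW b 0 := by
  intro z
  by_cases hz : z = w
  · subst hz
    rw [Pi.smul_apply, smul_eq_mul, expW_mul_expW]
    simp [expW]
  · simp [hz]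

lemma nStep_eq_op_pow_indicator {α : Type*} (p : α → α → ℝ≥0∞) (n : ℕ) (z w : α) :
    nStep p n z w = (op p ^ n) (Set.indicator {w} 1) z := by
  classical
  rw [nStep_eq_op_pow]
  refine congrFun (congrArg _ (funext fun v => ?_)) z
  by_cases hv : v = w
  · subst hv; simp
  · simp [hv]

/-- The Green function as a sum over the number of blocks of length `m` and the remainder. -/
lemma green_eq_tsum_prod {α : Type*} (p : α → α → ℝ≥0∞) {m : ℕ} [NeZero m] (z w : α) :
    green p z w =
      ∑' x : ℕ × Fin m, ((op p ^ m) ^ x.1) ((op p ^ (x.2 : ℕ)) (Set.indicator {w} 1)) z := by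
  rw [green, ← (Nat.divModEquiv m).symm.tsum_eq]
  refine tsum_congr fun x => ?_
  rw [nStep_eq_op_pow_indicator, ← Module.End.mul_apply, ← pow_mul, ← pow_add, mul_comm m]
  rfl

/-- The total contribution of the exceptional terms decays exponentially in the direction of the
drift. -/
lemma exists_tsum_error_le {ν : PMF (ℤ × ℤ)} {m : ℕ} {A : Module.End ℝ≥0∞ (ℤ × ℤ → ℝ≥0∞)}
    (hA : ∀ f g, f ≤ g → A f ≤ A g) {b R c : ℝ} (hc : 0 ≤ c) (hcR : c * R < 1)
    (hb : genFun ν b 0 ≠ ⊤)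
    (hAe : A (expW b 0) ≤ ENNReal.ofReal R • expW b 0) :
    ∃ D : ℝ≥0∞, D ≠ ⊤ ∧ ∀ z w : ℤ × ℤ,
      ∑' x : ℕ × Fin m, ENNReal.ofReal (c ^ (x.1 + 1)) *
        (A ^ (x.1 + 1)) ((op (killedKernel ν halfPlane) ^ (x.2 : ℕ)) (Set.indicator {w} 1)) z ≤
      D * expW b 0 (z - w) := by
  set r := ENNReal.ofReal (c * R) with hr
  have hr1 : r < 1 := by simpa [hr] using hcR
  refine ⟨(∑' n : ℕ, r ^ (n + 1)) * ∑ i : Fin m, genFun ν b 0 ^ (i : ℕ), ?_, fun z w => ?_⟩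
  · refine ENNReal.mul_ne_top ?_ (ENNReal.sum_ne_top.2 fun i _ => ENNReal.pow_ne_top hb)
    have : ∑' n : ℕ, r ^ (n + 1) ≤ ∑' n : ℕ, r ^ n :=
      ENNReal.tsum_comp_le_tsum_of_injective (add_left_injective 1) fun n => r ^ n
    refine ne_top_of_le_ne_top ?_ this
    rw [ENNReal.tsum_geometric]
    simpa using (tsub_pos_of_lt hr1).ne'
  · have hterm : ∀ x : ℕ × Fin m, ENNReal.ofReal (c ^ (x.1 + 1)) *
        (A ^ (x.1 + 1)) ((op (killedKernel ν halfPlane) ^ (x.2 : ℕ)) (Set.indicator {w} 1)) z ≤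
        r ^ (x.1 + 1) * (genFun ν b 0 ^ (x.2 : ℕ) * expW b 0 (z - w)) := by
      rintro ⟨n, i⟩
      have h1 : (op (killedKernel ν halfPlane) ^ (i : ℕ)) (Set.indicator {w} 1) ≤
          (expW (-b) 0 w * genFun ν b 0 ^ (i : ℕ)) • expW b 0 := by
        refine (op_pow_mono _ _ (single_le_expW b w)).trans ?_
        rw [map_smul, mul_smul]
        have := pow_apply_le_of_apply_le (fun _ _ => op_mono _)
          (op_killedKernel_expW_le ν halfPlane b 0) (i : ℕ)
        intro z
        simp only [Pi.smul_apply]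
        gcongr
        exact this z
      have hpm : ∀ n, ∀ f g, f ≤ g → (A ^ n) f ≤ (A ^ n) g := by
        intro n
        induction n with
        | zero => intro f g h; simpa using h
        | succ n ih =>
          intro f g h
          rw [pow_succ', Module.End.mul_apply, Module.End.mul_apply]
          exact hA _ _ (ih _ _ h)
      have h2 := (hpm (n + 1) _ _ h1) z
      rw [map_smul] at h2
      have h3 := pow_apply_le_of_apply_le hA hAe (n + 1) z
      simp only [Pi.smul_apply, smul_eq_mul] at h2 h3
      calc _ ≤ ENNReal.ofReal (c ^ (n + 1)) * (expW (-b) 0 w * genFun ν b 0 ^ (i : ℕ) *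
            (ENNReal.ofReal R ^ (n + 1) * expW b 0 z)) := by
            refine mul_le_mul_right (h2.trans ?_) _
            gcongr
        _ = _ := by
            rw [expW_sub, hr, ENNReal.ofReal_mul hc, mul_pow, ENNReal.ofReal_pow hc]
            ring
    refine (ENNReal.tsum_le_tsum hterm).trans (le_of_eq ?_)
    rw [ENNReal.tsum_prod (f := fun (n : ℕ) (i : Fin m) =>
      r ^ (n + 1) * (genFun ν b 0 ^ (i : ℕ) * expW b 0 (z - w)))]
    simp only [tsum_fintype, ← Finset.mul_sum, ← Finset.sum_mul, ENNReal.tsum_mul_right, mul_assoc]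

lemma green_eq_sum_add_tsum_prod {α : Type*} (p : α → α → ℝ≥0∞) {m : ℕ} [NeZero m] (z w : α) :
    green p z w = ∑ k ∈ Finset.range m, nStep p k z w +
      ∑' x : ℕ × Fin m,
        ((op p ^ m) ^ (x.1 + 1)) ((op p ^ (x.2 : ℕ)) (Set.indicator {w} 1)) z := by
  rw [green, ← ENNReal.summable.sum_add_tsum_nat_add' (k := m), ← (Nat.divModEquiv m).symm.tsum_eq]
  congr 1
  refine tsum_congr fun x => ?_
  rw [nStep_eq_op_pow_indicator, ← Module.End.mul_apply, ← pow_mul, ← pow_add]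
  rw [show (Nat.divModEquiv m).symm x + m = m * (x.1 + 1) + x.2 by
    change x.1 * m + x.2 + m = _
    ring]

/-- The weights `ρ ^ k c ^ N` that control the exceptional terms, for `ρ = exp l`. -/
lemma one_le_exp_pow_mul {l κ : ℝ} {k N : ℕ} (h : 0 ≤ l * (k - κ * N)) :
    1 ≤ Real.exp l ^ k * Real.exp (-(κ * l)) ^ N := by
  rw [← Real.exp_nat_mul, ← Real.exp_nat_mul, ← Real.exp_add, Real.one_le_exp_iff]
  linarith

lemma exp_mul_one_add_lt_one {l κ ε : ℝ} (h : (Real.exp l - 1) * ε < κ * l) :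
    Real.exp (-(κ * l)) * (1 + (Real.exp l - 1) * ε) < 1 := by
  have h1 := Real.add_one_le_exp ((Real.exp l - 1) * ε)
  calc Real.exp (-(κ * l)) * (1 + (Real.exp l - 1) * ε)
      ≤ Real.exp (-(κ * l)) * Real.exp ((Real.exp l - 1) * ε) := by gcongr; linarith
    _ < 1 := by rw [← Real.exp_add, Real.exp_lt_one_iff]; linarith

/-- For some number of steps `m ≥ 1`, the killed walk moves by `(1, 0)` in `m` steps with a
probability bounded below uniformly on the half-plane. -/
lemma exists_shift_nStep {ν : PMF (ℤ × ℤ)}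
    (h : IrreducibleOn (killedKernel ν quadrant) quadrant) :
    ∃ m : ℕ, m ≠ 0 ∧ ∃ ε : ℝ, 0 < ε ∧ ∀ z ∈ halfPlane,
      ENNReal.ofReal ε ≤ nStep (killedKernel ν halfPlane) m z (z + (1, 0)) := by
  obtain ⟨m, η, hη, hm⟩ := exists_le_nStep h (d := (0, 0)) (d' := (1, 0)) (by simp) (by simp)
  refine ⟨m, ?_, (min η 1).toReal, ?_, fun z hz => ?_⟩
  · rintro rfl
    have := hm (0, 1) (by simp [halfPlane])
    simp [nStep, hη] at this
  · exact ENNReal.toReal_pos (lt_min (pos_iff_ne_zero.2 hη) one_pos).ne' (by simp)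
  · rw [ENNReal.ofReal_toReal (ne_top_of_le_ne_top ENNReal.one_ne_top (min_le_right _ _))]
    refine (min_le_left _ _).trans ((hm z hz).trans (le_of_eq ?_))
    rw [show ((0, 0) : ℤ × ℤ) = 0 from rfl, add_zero]

/-- The Green function at `z + (1, 0)` is at most `1 + σ` times that at `z`, up to an error that
decays exponentially in the direction of the drift. -/
lemma HorizontalDrift.green_shift_le {ν : PMF (ℤ × ℤ)} {c₀ C : ℝ} (h : HorizontalDrift ν c₀ C)
    {σ : ℝ} (hσ : 0 < σ) :
    ∃ b : ℝ, 0 < b ∧ ∃ D : ℝ≥0∞, D ≠ ⊤ ∧ ∀ z ∈ halfPlane, ∀ w,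
      greenHalfPlane ν (z + (1, 0)) w ≤
        ENNReal.ofReal (1 + σ) * greenHalfPlane ν z w + D * expW b 0 (z - w) := by
  obtain ⟨m, hm, ε, hε, hstep⟩ := exists_shift_nStep h.irreducible
  obtain ⟨q, hcomm, hX⟩ := exists_op_pow_eq_smul_shift_add hm hstep
  have : NeZero m := ⟨hm⟩
  set l := Real.log (1 + σ / 2) with hl
  have hexp : Real.exp l = 1 + σ / 2 := Real.exp_log (by positivity)
  have hl0 : 0 < l := Real.log_pos (by linarith)
  have hl1 : σ / 2 < (1 + σ) * l := by
    have h1 : 1 - (1 + σ / 2)⁻¹ ≤ l := Real.one_sub_inv_le_log_of_pos (by positivity)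
    have h2 : σ / 2 < (1 + σ) * (1 - (1 + σ / 2)⁻¹) := by
      rw [show (1 + σ) * (1 - (1 + σ / 2)⁻¹) = (1 + σ) * (σ / 2) / (1 + σ / 2) by
        field_simp; ring, lt_div_iff₀ (by positivity)]
      nlinarith
    exact h2.trans_le (by gcongr)
  set c := Real.exp (-((1 + σ) * ε * l)) with hc
  have hw : ∀ k N : ℕ, (1 + σ) * ε * N ≤ k → 1 ≤ Real.exp l ^ k * c ^ N := fun k N hk =>
    one_le_exp_pow_mul (mul_nonneg hl0.le (by linarith))
  have hc1 : c * (1 + (Real.exp l - 1) * ε) < 1 := by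
    apply exp_mul_one_add_lt_one
    rw [hexp]
    nlinarith
  obtain ⟨b, hb, hb1, R, hcR, hgR⟩ :=
    h.exists_tilt (Real.exp_nonneg l) hε.le m hc1
  have hbtop : genFun ν b 0 ≠ ⊤ := ne_top_of_le_ne_top ENNReal.ofReal_ne_top
    (h.genFun_le b 0 (by rwa [abs_of_pos hb]) (by simp))
  obtain ⟨D, hD, herr⟩ := exists_tsum_error_le (m := m) (smul_shift_add_mono q _)
    (Real.exp_nonneg _) hcR hbtop (smul_shift_add_expW_le hm ENNReal.ofReal_ne_top hX hgR)
  refine ⟨b, hb, ENNReal.ofReal ε⁻¹ * D, ENNReal.mul_ne_top ENNReal.ofReal_ne_top hD,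
    fun z hz w => ?_⟩
  rw [mul_assoc]
  refine le_trans ?_ (add_le_add_right (mul_le_mul_right (herr z w) _) _)
  have h2 : ∑' x : ℕ × Fin m, ((op (killedKernel ν halfPlane) ^ m) ^ (x.1 + 1))
      ((op (killedKernel ν halfPlane) ^ (x.2 : ℕ)) (Set.indicator {w} 1)) z ≤
      greenHalfPlane ν z w := by
    rw [greenHalfPlane, green_eq_sum_add_tsum_prod (m := m)]
    exact le_add_self
  refine le_trans ?_ (add_le_add_left (mul_le_mul_right h2 _) _)
  rw [greenHalfPlane, green_eq_tsum_prod (m := m), ← ENNReal.tsum_mul_left,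
    ← ENNReal.tsum_mul_left, ← ENNReal.tsum_add]
  refine ENNReal.tsum_le_tsum fun x => ?_
  have key := shift_pow_le hcomm hε (Real.exp_nonneg l) (Real.exp_nonneg _) hσ hw x.1
    ((op (killedKernel ν halfPlane) ^ (x.2 : ℕ)) (Set.indicator {w} 1)) z
  rw [Module.End.mul_apply, shift_apply hz, ENNReal.ofReal_mul (by positivity), mul_assoc] at key
  rwa [hX]

/-- The reverse of `HorizontalDrift.green_shift_le`. -/
lemma HorizontalDrift.green_le_shift {ν : PMF (ℤ × ℤ)} {c₀ C : ℝ} (h : HorizontalDrift ν c₀ C)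
    {σ : ℝ} (hσ : 0 < σ) :
    ∃ b : ℝ, 0 < b ∧ ∃ D : ℝ≥0∞, D ≠ ⊤ ∧ ∀ z ∈ halfPlane, ∀ w,
      greenHalfPlane ν z w ≤
        ENNReal.ofReal (1 + σ) * greenHalfPlane ν (z + (1, 0)) w + D * expW b 0 (z - w) := by
  obtain ⟨m, hm, ε, hε, hstep⟩ := exists_shift_nStep h.irreducible
  obtain ⟨q, hcomm, hX⟩ := exists_op_pow_eq_smul_shift_add hm hstep
  have : NeZero m := ⟨hm⟩
  set l := -Real.log (1 + σ / 2) with hl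
  have hexp : Real.exp l = (1 + σ / 2)⁻¹ := by
    rw [hl, Real.exp_neg, Real.exp_log (by positivity)]
  have hl0 : l < 0 := neg_lt_zero.2 (Real.log_pos (by linarith))
  have hl1 : (1 + σ / 2)⁻¹ - 1 < (1 + σ)⁻¹ * l := by
    have h1 : -(σ / 2) ≤ l := by
      have := Real.log_le_sub_one_of_pos (show 0 < 1 + σ / 2 by positivity)
      linarith
    have h2 : (1 + σ / 2)⁻¹ - 1 < (1 + σ)⁻¹ * -(σ / 2) := by
      rw [show (1 + σ / 2)⁻¹ - 1 = -(σ / 2) / (1 + σ / 2) by field_simp; ring,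
        inv_mul_eq_div, div_lt_div_iff₀ (by positivity) (by positivity)]
      nlinarith
    exact h2.trans_le (by gcongr)
  set c := Real.exp (-((1 + σ)⁻¹ * ε * l)) with hc
  have hw : ∀ k N : ℕ, (1 + σ) * k ≤ ε * N → 1 ≤ Real.exp l ^ k * c ^ N := fun k N hk => by
    refine one_le_exp_pow_mul (mul_nonneg_of_nonpos_of_nonpos hl0.le ?_)
    rw [mul_assoc, inv_mul_eq_div, sub_nonpos, le_div_iff₀ (by positivity)]
    linarith
  have hc1 : c * (1 + (Real.exp l - 1) * ε) < 1 := by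
    apply exp_mul_one_add_lt_one
    rw [hexp]
    nlinarith
  obtain ⟨b, hb, hb1, R, hcR, hgR⟩ :=
    h.exists_tilt (Real.exp_nonneg l) hε.le m hc1
  have hbtop : genFun ν b 0 ≠ ⊤ := ne_top_of_le_ne_top ENNReal.ofReal_ne_top
    (h.genFun_le b 0 (by rwa [abs_of_pos hb]) (by simp))
  obtain ⟨D, hD, herr⟩ := exists_tsum_error_le (m := m) (smul_shift_add_mono q _)
    (Real.exp_nonneg _) hcR hbtop (smul_shift_add_expW_le hm ENNReal.ofReal_ne_top hX hgR)
  refine ⟨b, hb, (∑ k ∈ Finset.range m, genFun ν b 0 ^ k) + D, ENNReal.add_ne_top.2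
    ⟨ENNReal.sum_ne_top.2 fun k _ => ENNReal.pow_ne_top hbtop, hD⟩, fun z hz w => ?_⟩
  rw [add_mul, add_left_comm, greenHalfPlane, green_eq_sum_add_tsum_prod (m := m)]
  gcongr ?_ + ?_
  · rw [Finset.sum_mul]
    refine Finset.sum_le_sum fun k _ => ?_
    -- these short paths are bounded through the weight `exp(b z₁)`
    have h1 := mul_le_mul_left (nStep_mul_expW_le ν halfPlane b 0 k z w) (expW (-b) 0 w)
    rw [mul_assoc, expW_mul_expW, mul_assoc] at h1
    rw [add_neg_cancel, add_zero, expW_zero_zero, mul_one] at h1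
    rwa [expW_sub, mul_comm (expW _ _ _)]
  · refine le_trans ?_ (add_le_add_right (herr z w) _)
    rw [greenHalfPlane, green_eq_tsum_prod (m := m), ← ENNReal.tsum_mul_left, ← ENNReal.tsum_add]
    refine ENNReal.tsum_le_tsum fun x => ?_
    have key := pow_succ_le_shift_pow hcomm hε (Real.exp_nonneg l) (Real.exp_nonneg _) hσ hw x.1
      ((op (killedKernel ν halfPlane) ^ (x.2 : ℕ)) (Set.indicator {w} 1)) z
    rw [Module.End.mul_apply, shift_apply hz] at key
    rwa [hX]


/-! ### Paths of subexponential cost -/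

/-- The function `(exp(θ z₂) - 1)⁺`, which is subharmonic for the killed walk with the factor
`φ(0, θ)`. It vanishes off the half-plane. -/
def expSubOne (θ : ℝ) (z : ℤ × ℤ) : ℝ≥0∞ := ENNReal.ofReal (Real.exp (θ * z.2) - 1)

lemma expSubOne_of_notMem {θ : ℝ} (hθ : 0 ≤ θ) {z : ℤ × ℤ} (hz : z ∉ halfPlane) :
    expSubOne θ z = 0 := by
  have h : z.2 ≤ 0 := not_lt.1 hz
  have h' : (z.2 : ℝ) ≤ 0 := by exact_mod_cast h
  refine ENNReal.ofReal_of_nonpos (sub_nonpos.2 (Real.exp_le_one_iff.2 ?_))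
  exact mul_nonpos_of_nonneg_of_nonpos hθ h'

lemma expSubOne_le (θ : ℝ) (z : ℤ × ℤ) : expSubOne θ z ≤ expW 0 θ z := by
  refine ENNReal.ofReal_le_ofReal ?_
  simp

lemma expSubOne_add_one {θ : ℝ} (hθ : 0 ≤ θ) {z : ℤ × ℤ} (hz : z ∈ halfPlane) :
    expSubOne θ z + 1 = expW 0 θ z := by
  have h' : (0 : ℝ) ≤ z.2 := by exact_mod_cast (le_of_lt hz : 0 ≤ z.2)
  rw [expSubOne, expW, ← ENNReal.ofReal_one, ← ENNReal.ofReal_add _ zero_le_one]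
  · simp
  · exact sub_nonneg.2 (Real.one_le_exp (by positivity))

/-- Killing only removes points where `exp(θ z₂) - 1` is negative. -/
lemma genFun_smul_expSubOne_le {ν : PMF (ℤ × ℤ)} {θ : ℝ} (hθ : 0 ≤ θ) (h1 : 1 ≤ genFun ν 0 θ) :
    genFun ν 0 θ • expSubOne θ ≤ op (killedKernel ν halfPlane) (expSubOne θ) := by
  intro z
  rw [Pi.smul_apply, smul_eq_mul]
  by_cases hz : z ∈ halfPlane
  · have key : genFun ν 0 θ * expW 0 θ z ≤
        op (killedKernel ν halfPlane) (expSubOne θ) z + 1 := by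
      rw [genFun, ← ENNReal.tsum_mul_right, op_apply, ← ν.tsum_coe,
        ← (Equiv.addRight z).tsum_eq (fun w => killedKernel ν halfPlane z w * expSubOne θ w),
        ← ENNReal.tsum_add]
      refine ENNReal.tsum_le_tsum fun v => ?_
      rw [Equiv.coe_addRight, mul_assoc, ← expW_add]
      by_cases hv : v + z ∈ halfPlane
      · rw [← expSubOne_add_one hθ hv, mul_add, mul_one, killedKernel, if_pos ⟨hz, hv⟩]
        simp
      · refine le_trans ?_ le_add_self
        refine mul_le_of_le_one_right' ?_
        have h : (v + z).2 ≤ 0 := not_lt.1 hv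
        have h' : (((v + z).2 : ℤ) : ℝ) ≤ 0 := by exact_mod_cast h
        rw [expW, ENNReal.ofReal_le_one, Real.exp_le_one_iff]
        nlinarith
    refine (ENNReal.add_le_add_iff_right ENNReal.one_ne_top).1 (le_trans ?_ key)
    rw [← expSubOne_add_one hθ hz, mul_add, mul_one]
    gcongr
  · rw [expSubOne_of_notMem hθ hz, mul_zero]
    exact zero_le

lemma le_tsum_nStep_mul_expSubOne {ν : PMF (ℤ × ℤ)} {θ : ℝ} (hθ : 0 ≤ θ)
    (h1 : 1 ≤ genFun ν 0 θ) (n : ℕ) (z : ℤ × ℤ) :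
    genFun ν 0 θ ^ n * expSubOne θ z ≤
      ∑' w, nStep (killedKernel ν halfPlane) n z w * expSubOne θ w := by
  rw [← op_pow_apply]
  exact le_pow_apply_of_le_apply (fun _ _ => op_mono _) (genFun_smul_expSubOne_le hθ h1) n z

lemma tsum_exp_neg_abs_ne_top {a : ℝ} (ha : 0 < a) :
    ∑' k : ℤ, ENNReal.ofReal (Real.exp (-(a * |(k : ℝ)|))) ≠ ⊤ := by
  refine Summable.tsum_ofReal_ne_top ?_
  have h : Summable fun n : ℕ => Real.exp (n * -a) := Real.summable_exp_nat_mul_iff.2 (by linarith)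
  refine Summable.of_nat_of_neg ?_ ?_ <;>
  · refine h.congr fun n => ?_
    simp [mul_comm]

lemma tsum_nStep_le_one (ν : PMF (ℤ × ℤ)) (n : ℕ) (z : ℤ × ℤ) :
    ∑' w, nStep (killedKernel ν halfPlane) n z w ≤ 1 := by
  have h := tsum_nStep_mul_expW_le ν halfPlane 0 0 n z
  simpa [expW_zero_zero, genFun_zero_zero] using h

/-- The killed walk climbs by some `L ≥ 1` levels, staying above its starting level, with
probability at least `exp(-σ L)`: otherwise the expectations of `exp(θ z₂)`, `θ = σ / 2`, would
stay bounded. -/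
lemma HorizontalDrift.exists_climb {ν : PMF (ℤ × ℤ)} {c C : ℝ} (h : HorizontalDrift ν c C)
    {σ : ℝ} (hσ : 0 < σ) :
    ∃ n L : ℕ, 1 ≤ L ∧ ENNReal.ofReal (Real.exp (-(σ * L))) <
      ∑' j : ℤ, nStep (killedKernel ν halfPlane) n (0, 1) (j, 1 + L) := by
  by_contra! hcon
  obtain ⟨θ, hθσ, hθ⟩ : ∃ θ : ℝ, σ = 2 * θ ∧ 0 < θ := ⟨σ / 2, by ring, by positivity⟩
  have hgt := h.one_lt_genFun θ hθ
  set S : ℝ≥0∞ := ∑' k : ℤ, ENNReal.ofReal (Real.exp (-(θ * |(k : ℝ)|))) with hS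
  have hStop : S ≠ ⊤ := tsum_exp_neg_abs_ne_top hθ
  have hbound : ∀ n, genFun ν 0 θ ^ n * expSubOne θ (0, 1) ≤
      ENNReal.ofReal (Real.exp θ) * S := by
    intro n
    refine (le_tsum_nStep_mul_expSubOne hθ.le hgt.le n (0, 1)).trans ?_
    rw [ENNReal.tsum_prod (f := fun j y => nStep (killedKernel ν halfPlane) n (0, 1) (j, y) *
      expSubOne θ (j, y)), ENNReal.tsum_comm, hS, ← ENNReal.tsum_mul_left,
      ← (Equiv.addRight (1 : ℤ)).tsum_eq]
    refine ENNReal.tsum_le_tsum fun k => ?_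
    rw [Equiv.coe_addRight]
    rcases lt_or_ge k 0 with hk | hk
    · have : ∀ j : ℤ, expSubOne θ (j, k + 1) = 0 := fun j =>
        expSubOne_of_notMem hθ.le (by simp [halfPlane]; omega)
      simp [this]
    · obtain ⟨L, rfl⟩ := Int.eq_ofNat_of_zero_le hk
      have h1 : ∀ j : ℤ, expSubOne θ (j, (L : ℤ) + 1) ≤
          ENNReal.ofReal (Real.exp θ * Real.exp (θ * L)) := fun j => by
        refine (expSubOne_le θ _).trans (le_of_eq ?_)
        rw [expW, ← Real.exp_add]
        congr 2
        push_cast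
        ring
      have h2 : ∑' j : ℤ, nStep (killedKernel ν halfPlane) n (0, 1) (j, (L : ℤ) + 1) ≤
          ENNReal.ofReal (Real.exp (-(σ * L))) := by
        rcases Nat.eq_zero_or_pos L with rfl | hL
        · simp only [Nat.cast_zero, mul_zero, neg_zero, Real.exp_zero, ENNReal.ofReal_one]
          refine le_trans ?_ (tsum_nStep_le_one ν n (0, 1))
          exact ENNReal.tsum_comp_le_tsum_of_injective
            (f := fun j : ℤ => (j, (0 : ℤ) + 1)) (fun a b hab => (Prod.ext_iff.1 hab).1) _
        · rw [add_comm]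
          exact hcon n L hL
      calc _ ≤ ∑' j : ℤ, nStep (killedKernel ν halfPlane) n (0, 1) (j, (L : ℤ) + 1) *
            ENNReal.ofReal (Real.exp θ * Real.exp (θ * L)) :=
            ENNReal.tsum_le_tsum fun j => mul_le_mul_right (h1 j) _
        _ ≤ ENNReal.ofReal (Real.exp (-(σ * L))) *
            ENNReal.ofReal (Real.exp θ * Real.exp (θ * L)) := by
            rw [ENNReal.tsum_mul_right]
            gcongr
        _ = _ := by
            rw [← ENNReal.ofReal_mul (Real.exp_nonneg _), ← ENNReal.ofReal_mul (Real.exp_nonneg _),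
              ← Real.exp_add, ← Real.exp_add, ← Real.exp_add, hθσ]
            congr 2
            simp
            ring
  have hf : expSubOne θ (0, 1) ≠ 0 := by
    simp [expSubOne, hθ]
  have hlim : Tendsto (fun n : ℕ => genFun ν 0 θ ^ n * expSubOne θ (0, 1)) atTop (𝓝 ⊤) := by
    have := ENNReal.Tendsto.mul_const (ENNReal.tendsto_pow_atTop_nhds_top_iff.2 hgt)
      (b := expSubOne θ (0, 1)) (Or.inl ENNReal.top_ne_zero)
    rwa [ENNReal.top_mul hf] at this
  obtain ⟨n, hn⟩ := (hlim.eventually (lt_mem_nhds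
    (ENNReal.mul_ne_top ENNReal.ofReal_ne_top hStop).lt_top)).exists
  exact absurd (hbound n) (not_le.2 hn)

lemma HorizontalDrift.genFun_le_exp {ν : PMF (ℤ × ℤ)} {c C : ℝ} (h : HorizontalDrift ν c C)
    {s t : ℝ} (hs : |s| ≤ 1) (ht : |t| ≤ 1) (n : ℕ) :
    genFun ν s t ^ n ≤ ENNReal.ofReal (Real.exp ((c * s + C * (s ^ 2 + t ^ 2)) * n)) := by
  rw [mul_comm, Real.exp_nat_mul, ENNReal.ofReal_pow (Real.exp_nonneg _)]
  refine pow_le_pow_left' ((h.genFun_le s t hs ht).trans (ENNReal.ofReal_le_ofReal ?_)) n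
  linarith [Real.add_one_le_exp (c * s + C * (s ^ 2 + t ^ 2))]

/-- The killed walk moves to the right along directions arbitrarily close to `(1, 0)` with
subexponential cost. Otherwise the expectation of `(exp(θ z₂) - 1)⁺` at time `n` would tend to
zero: the contributions of the points with `z₁ < c n / 2` and of those with
`z₂ - 1 > η z₁ ≥ η c n / 2` are exponentially small for `θ` small, as the comparison with the
weights `exp(-θ z₁ + θ z₂)` and `exp(2 θ z₂)` shows. -/
lemma HorizontalDrift.exists_slide {ν : PMF (ℤ × ℤ)} {c C : ℝ} (h : HorizontalDrift ν c C)
    {η : ℝ} (hη : 0 < η) :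
    ∃ n j L : ℕ, 1 ≤ j ∧ (L : ℝ) ≤ η * j ∧ ENNReal.ofReal (Real.exp (-(η * j))) <
      nStep (killedKernel ν halfPlane) n (0, 1) (j, 1 + L) := by
  by_contra! hcon
  have hc := h.c_pos
  have hC := h.C_nonneg
  obtain ⟨θ, hθ, hθ1, hθ2, hθ3⟩ : ∃ θ : ℝ, 0 < θ ∧ θ ≤ 1 / 4 ∧ 4 * C * θ < η * c / 2 ∧
      2 * C * θ < c / 2 := by
    refine ⟨min (1 / 4) (min (η * c / (8 * (C + 1))) (c / (4 * (C + 1)))), by positivity,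
      min_le_left _ _, ?_, ?_⟩
    · have h1 : min (1 / 4) (min (η * c / (8 * (C + 1))) (c / (4 * (C + 1)))) ≤
        η * c / (8 * (C + 1)) := (min_le_right _ _).trans (min_le_left _ _)
      have h2 : 4 * (C + 1) * (η * c / (8 * (C + 1))) = η * c / 2 := by field_simp; norm_num
      have h3 : 0 < min (1 / 4) (min (η * c / (8 * (C + 1))) (c / (4 * (C + 1)))) := by positivity
      nlinarith
    · have h1 : min (1 / 4) (min (η * c / (8 * (C + 1))) (c / (4 * (C + 1)))) ≤
        c / (4 * (C + 1)) := (min_le_right _ _).trans (min_le_right _ _)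
      have h2 : 2 * (C + 1) * (c / (4 * (C + 1))) = c / 2 := by field_simp; norm_num
      have h3 : 0 < min (1 / 4) (min (η * c / (8 * (C + 1))) (c / (4 * (C + 1)))) := by positivity
      nlinarith
  set κ := c / 2 with hκ
  have hκ0 : 0 < κ := by positivity
  obtain ⟨a, ha, ha1, ha2, ha3⟩ : ∃ a : ℝ, 0 < a ∧ θ * κ + (c * -θ + C * ((-θ) ^ 2 + θ ^ 2)) ≤ -a ∧
      -(θ * (η * κ)) + (c * 0 + C * (0 ^ 2 + (2 * θ) ^ 2)) ≤ -a ∧ -(η * κ / 4) ≤ -a := by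
    refine ⟨min (min (θ * (κ - 2 * C * θ)) (θ * (η * κ - 4 * C * θ))) (η * κ / 4), ?_, ?_, ?_, ?_⟩
    · refine lt_min (lt_min (mul_pos hθ (by linarith)) (mul_pos hθ ?_)) (by positivity)
      rw [hκ]; linarith
    · have : min (min (θ * (κ - 2 * C * θ)) (θ * (η * κ - 4 * C * θ))) (η * κ / 4) ≤
        θ * (κ - 2 * C * θ) := (min_le_left _ _).trans (min_le_left _ _)
      have e : θ * κ + (c * -θ + C * ((-θ) ^ 2 + θ ^ 2)) = - (θ * (κ - 2 * C * θ)) := by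
        rw [hκ]; ring
      rw [e]; linarith
    · have : min (min (θ * (κ - 2 * C * θ)) (θ * (η * κ - 4 * C * θ))) (η * κ / 4) ≤
        θ * (η * κ - 4 * C * θ) := (min_le_left _ _).trans (min_le_right _ _)
      linarith
    · exact neg_le_neg (min_le_right _ _)
  set S₁ : ℝ≥0∞ := ∑' k : ℤ, ENNReal.ofReal (Real.exp (-(η / 4 * |(k : ℝ)|))) with hS₁
  set S₂ : ℝ≥0∞ := ∑' k : ℤ, ENNReal.ofReal (Real.exp (-(1 / 4 * |(k : ℝ)|))) with hS₂
  set M : ℝ≥0∞ := expW (-θ) θ (0, 1) + expW 0 (2 * θ) (0, 1) +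
    ENNReal.ofReal (Real.exp θ) * (S₁ * S₂) with hM
  have hMtop : M ≠ ⊤ := by
    refine ENNReal.add_ne_top.2 ⟨ENNReal.add_ne_top.2 ⟨expW_ne_top _ _ _, expW_ne_top _ _ _⟩,
      ENNReal.mul_ne_top ENNReal.ofReal_ne_top (ENNReal.mul_ne_top
        (tsum_exp_neg_abs_ne_top (by positivity)) (tsum_exp_neg_abs_ne_top (by positivity)))⟩
  have hbound : ∀ n : ℕ, 1 ≤ n →
      expSubOne θ (0, 1) ≤ ENNReal.ofReal (Real.exp (-a * n)) * M := by
    intro n hn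
    have hn' : (1 : ℝ) ≤ n := by exact_mod_cast hn
    set p := nStep (killedKernel ν halfPlane) n (0, 1) with hp
    have hgt := h.one_lt_genFun θ hθ
    have hlow : expSubOne θ (0, 1) ≤ ∑' w, p w * expSubOne θ w :=
      (le_mul_of_one_le_left' (one_le_pow_of_one_le' hgt.le n)).trans
        (le_tsum_nStep_mul_expSubOne hθ.le hgt.le n (0, 1))
    refine hlow.trans ?_
    have hpt : ∀ w : ℤ × ℤ, p w * expSubOne θ w ≤
        ENNReal.ofReal (Real.exp (θ * κ * n)) * (p w * expW (-θ) θ w) +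
        ENNReal.ofReal (Real.exp (-(θ * (η * κ)) * n)) * (p w * expW 0 (2 * θ) w) +
        ENNReal.ofReal (Real.exp (-a * n)) * (ENNReal.ofReal (Real.exp θ) *
          (ENNReal.ofReal (Real.exp (-(η / 4 * |(w.1 : ℝ)|))) *
            ENNReal.ofReal (Real.exp (-(1 / 4 * |((w.2 - 1 : ℤ) : ℝ)|))))) := by
      intro w
      by_cases hw : w ∈ halfPlane
      swap
      · rw [expSubOne_of_notMem hθ.le hw, mul_zero]
        exact zero_le
      have hw1 : 1 ≤ w.2 := hw
      have hw1' : (1 : ℝ) ≤ w.2 := by exact_mod_cast hw1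
      have hexp := expSubOne_le θ w
      rcases lt_or_ge (w.1 : ℝ) (κ * n) with h1 | h1
      · refine le_add_right (le_add_right ?_)
        rw [mul_left_comm]
        refine mul_le_mul_right (hexp.trans ?_) _
        rw [expW, expW, ← ENNReal.ofReal_mul (Real.exp_nonneg _), ← Real.exp_add]
        refine ENNReal.ofReal_le_ofReal (Real.exp_le_exp.2 ?_)
        nlinarith
      rcases lt_or_ge (η * w.1) (w.2 - 1 : ℝ) with h2 | h2
      · refine le_add_right (le_add_left ?_)
        rw [mul_left_comm]
        refine mul_le_mul_right (hexp.trans ?_) _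
        rw [expW, expW, ← ENNReal.ofReal_mul (Real.exp_nonneg _), ← Real.exp_add]
        refine ENNReal.ofReal_le_ofReal (Real.exp_le_exp.2 ?_)
        have : η * κ * n ≤ w.2 := by nlinarith
        nlinarith
      · refine le_add_left ?_
        have hw0 : (0 : ℝ) < w.1 := lt_of_lt_of_le (by positivity) h1
        have hw0' : 0 < w.1 := by exact_mod_cast hw0
        obtain ⟨j, hj⟩ := Int.eq_ofNat_of_zero_le hw0'.le
        obtain ⟨L, hL⟩ := Int.eq_ofNat_of_zero_le (sub_nonneg.2 hw1)
        have hL' : (w.2 : ℝ) = 1 + L := by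
          have : w.2 = 1 + L := by omega
          rw [this]; push_cast; ring
        have hj' : (w.1 : ℝ) = j := by rw [hj]; simp
        have hpw : p w ≤ ENNReal.ofReal (Real.exp (-(η * j))) := by
          have := hcon n j L (by omega) (by rw [hj', hL'] at h2; linarith)
          rwa [show ((j : ℤ), (1 : ℤ) + L) = w from Prod.ext hj.symm (by simp; omega)] at this
        refine (mul_le_mul' hpw hexp).trans ?_
        rw [expW, ← ENNReal.ofReal_mul (Real.exp_nonneg _),
          ← ENNReal.ofReal_mul (Real.exp_nonneg _), ← ENNReal.ofReal_mul (Real.exp_nonneg _), ← ENNReal.ofReal_mul (Real.exp_nonneg _),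
          ← Real.exp_add, ← Real.exp_add, ← Real.exp_add, ← Real.exp_add]
        refine ENNReal.ofReal_le_ofReal (Real.exp_le_exp.2 ?_)
        rw [hL, Int.cast_natCast, Nat.abs_cast, hj', hL', Nat.abs_cast]
        rw [hj'] at h1
        rw [hj', hL'] at h2
        have hj0 : (0 : ℝ) ≤ j := by positivity
        have hL0 : (0 : ℝ) ≤ L := by positivity
        have e1 : θ * L ≤ 1 / 4 * L := by gcongr
        have e2 : η * κ / 4 * n ≤ η / 4 * j := by nlinarith
        have e3 : a * n ≤ η * κ / 4 * n := by gcongr; linarith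
        nlinarith
    refine (ENNReal.tsum_le_tsum hpt).trans ?_
    rw [ENNReal.tsum_add, ENNReal.tsum_add, ENNReal.tsum_mul_left, ENNReal.tsum_mul_left,
      ENNReal.tsum_mul_left, ENNReal.tsum_mul_left, hM, mul_add, mul_add]
    have hθa : |θ| ≤ 1 := by rw [abs_of_pos hθ]; linarith
    refine add_le_add (add_le_add ?_ ?_) (le_of_eq ?_)
    · refine (mul_le_mul_right (tsum_nStep_mul_expW_le ν halfPlane (-θ) θ n (0, 1)) _).trans ?_
      rw [← mul_assoc]
      refine mul_le_mul_left ?_ _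
      refine (mul_le_mul_right (h.genFun_le_exp (by rwa [abs_neg]) hθa n) _).trans ?_
      rw [← ENNReal.ofReal_mul (Real.exp_nonneg _), ← Real.exp_add, ← add_mul]
      gcongr
    · refine (mul_le_mul_right (tsum_nStep_mul_expW_le ν halfPlane 0 (2 * θ) n (0, 1)) _).trans ?_
      rw [← mul_assoc]
      refine mul_le_mul_left ?_ _
      refine (mul_le_mul_right (h.genFun_le_exp (by simp)
        (by rw [abs_of_pos (by positivity)]; linarith) n) _).trans ?_
      rw [← ENNReal.ofReal_mul (Real.exp_nonneg _), ← Real.exp_add, ← add_mul]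
      gcongr
    · congr 2
      rw [ENNReal.tsum_prod (f := fun (x y : ℤ) =>
        ENNReal.ofReal (Real.exp (-(η / 4 * |(x : ℝ)|))) *
            ENNReal.ofReal (Real.exp (-(1 / 4 * |((y - 1 : ℤ) : ℝ)|))))]
      simp only [ENNReal.tsum_mul_left, ENNReal.tsum_mul_right]
      rw [hS₁, hS₂, ← (Equiv.subRight (1 : ℤ)).tsum_eq
        (fun k : ℤ => ENNReal.ofReal (Real.exp (-(1 / 4 * |(k : ℝ)|))))]
      rfl
  have hlim : Tendsto (fun n : ℕ => ENNReal.ofReal (Real.exp (-a * n)) * M) atTop (𝓝 0) := by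
    have h1 : Tendsto (fun n : ℕ => Real.exp (-a * n)) atTop (𝓝 0) := by
      refine Real.tendsto_exp_atBot.comp ?_
      exact Tendsto.const_mul_atTop_of_neg (by linarith) tendsto_natCast_atTop_atTop
    have := ENNReal.Tendsto.mul_const (ENNReal.tendsto_ofReal h1) (b := M) (Or.inr hMtop)
    simpa using this
  have hf : 0 < expSubOne θ (0, 1) := by
    simp [expSubOne, hθ]
  obtain ⟨n, hn, hn1⟩ := ((hlim.eventually (gt_mem_nhds hf)).and (eventually_ge_atTop 1)).exists
  exact absurd (hbound n hn1) (not_le.2 hn)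

/-- The Green function decays subexponentially in the direction of the drift, and at most
exponentially in the distance to the boundary. -/
lemma HorizontalDrift.exists_le_green {ν : PMF (ℤ × ℤ)} {c C : ℝ} (h : HorizontalDrift ν c C) :
    ∃ K : ℝ, 0 ≤ K ∧ ∀ η : ℝ, 0 < η → ∃ D : ℝ, ∀ z ∈ halfPlane, ∀ w ∈ halfPlane, z.1 ≤ w.1 →
      1 ≤ ENNReal.ofReal (Real.exp (D + η * (w.1 - z.1) + K * (z.2 + w.2))) *
        greenHalfPlane ν z w := by
  obtain ⟨K, hK, hh⟩ := harnack h.irreducible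
  refine ⟨K, hK, fun η hη => ?_⟩
  have hη' : 0 < η / (1 + K) := by positivity
  obtain ⟨n, j, L, hj, hL, hp⟩ := h.exists_slide hη'
  refine ⟨K * j, fun z hz w hw hzw => ?_⟩
  obtain ⟨d, hd⟩ := Int.eq_ofNat_of_zero_le (sub_nonneg.2 hzw)
  set i := d / j with hi
  have hdi : d = j * i + d % j := (Nat.div_add_mod d j).symm
  have hmod : d % j < j := Nat.mod_lt _ hj
  have hz0 : 0 < z.2 := hz
  have hw0 : 0 < w.2 := hw
  have hz0' : (1 : ℝ) ≤ z.2 := by exact_mod_cast hz0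
  have hw0' : (1 : ℝ) ≤ w.2 := by exact_mod_cast hw0
  have hone : ∀ x : ℤ, (x, (1 : ℤ)) ∈ halfPlane := fun x => by simp [halfPlane]
  -- one block of length `j` along the first line of the half-plane
  have hblock : ∀ x : ℤ, greenHalfPlane ν (x + j, 1) w ≤
      ENNReal.ofReal (Real.exp (η * j)) * greenHalfPlane ν (x, 1) w := by
    intro x
    have h1 := hh (x + j, 1 + L) (by simp [halfPlane]; omega) (x + j, 1) (hone _) w
    have h2 : nStep (killedKernel ν halfPlane) n (x, 1) (x + j, 1 + L) *
        greenHalfPlane ν (x + j, 1 + L) w ≤ greenHalfPlane ν (x, 1) w :=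
      nStep_mul_green_le _ n _ _ w
    have h3 : nStep (killedKernel ν halfPlane) n (x, 1) (x + j, 1 + L) =
        nStep (killedKernel ν halfPlane) n (0, 1) (j, 1 + L) := by
      have := nStep_killedKernel_translate ν (v := (x, 0)) rfl n (0, 1) (j, 1 + L)
      rw [← this]
      congr 1 <;> ext <;> simp [add_comm]
    rw [h3] at h2
    have h4 : greenHalfPlane ν (x + j, 1 + L) w ≤
        ENNReal.ofReal (Real.exp (η / (1 + K) * j)) * greenHalfPlane ν (x, 1) w := by
      calc greenHalfPlane ν (x + j, 1 + L) w
          = ENNReal.ofReal (Real.exp (η / (1 + K) * j)) *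
            (ENNReal.ofReal (Real.exp (-(η / (1 + K) * j))) *
              greenHalfPlane ν (x + j, 1 + L) w) := by
            rw [← mul_assoc, ← ENNReal.ofReal_mul (Real.exp_nonneg _), ← Real.exp_add]
            simp
        _ ≤ _ := by
            refine mul_le_mul_right (le_trans ?_ h2) _
            exact mul_le_mul_left hp.le _
    refine h1.trans ((mul_le_mul_right h4 _).trans ?_)
    rw [← mul_assoc, ← ENNReal.ofReal_mul (Real.exp_nonneg _), ← Real.exp_add]
    refine mul_le_mul_left (ENNReal.ofReal_le_ofReal (Real.exp_le_exp.2 ?_)) _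
    simp only [sub_self, abs_zero, zero_add]
    push_cast
    rw [show (1 : ℝ) - (1 + L) = -L by ring, abs_neg, Nat.abs_cast]
    calc K * (L : ℝ) + η / (1 + K) * j ≤ K * (η / (1 + K) * j) + η / (1 + K) * j := by gcongr
      _ = η * j := by field_simp; ring
  have hblocks := le_exp_mul_of_step (g := fun k : ℕ => greenHalfPlane ν (z.1 + k * j, 1) w)
    (K := η * j) (N := i) fun k _ => by
      have := hblock (z.1 + k * j)
      rwa [show z.1 + k * j + j = z.1 + ((k + 1 : ℕ) : ℤ) * j by push_cast; ring] at this
  have hstart := hh z hz (z.1, 1) (hone _) w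
  have hend := hh (z.1 + i * j, 1) (hone _) w hw w
  refine (one_le_green_self _ w).trans (hend.trans ((mul_le_mul_right hblocks _).trans ?_))
  simp only [Nat.cast_zero, zero_mul, add_zero]
  refine (mul_le_mul_right (mul_le_mul_right hstart _) _).trans ?_
  rw [← mul_assoc, ← mul_assoc, ← ENNReal.ofReal_mul (Real.exp_nonneg _),
    ← ENNReal.ofReal_mul (mul_nonneg (Real.exp_nonneg _) (Real.exp_nonneg _)),
    ← Real.exp_add, ← Real.exp_add]
  refine mul_le_mul_left (ENNReal.ofReal_le_ofReal (Real.exp_le_exp.2 ?_)) _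
  have e0 : (w.1 : ℝ) - z.1 = d := by
    have : ((w.1 - z.1 : ℤ) : ℝ) = ((d : ℤ) : ℝ) := by rw [hd]
    push_cast at this
    exact this
  have e1 : (d : ℝ) = j * i + (d % j : ℕ) := by exact_mod_cast hdi
  have e2 : ((d % j : ℕ) : ℝ) ≤ j := by exact_mod_cast hmod.le
  have e3 : (0 : ℝ) ≤ ((d % j : ℕ) : ℝ) := by positivity
  have e4 : (w.1 : ℝ) - ((z.1 + i * j : ℤ) : ℝ) = (d % j : ℕ) := by
    push_cast
    linarith
  rw [e4, abs_of_nonneg e3, e0]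
  simp only [sub_self, abs_zero, zero_add, Int.cast_one]
  rw [abs_of_nonneg (by linarith), abs_of_nonpos (by linarith)]
  have e5 : η * (j * i) ≤ η * d := by
    gcongr
    linarith
  nlinarith [mul_le_mul_of_nonneg_left e2 hK]


/-! ### Ratio bounds -/

/-- The error terms of the horizontal ratio bounds are negligible with respect to the Green
function, when the distance `m` to the target is large and the starting point is within `δ m` of
the origin. -/
lemma HorizontalDrift.error_le {ν : PMF (ℤ × ℤ)} {c C : ℝ} (h : HorizontalDrift ν c C)
    {b σ : ℝ} (hb : 0 < b) (hσ : 0 < σ) {D : ℝ≥0∞} (hD : D ≠ ⊤) :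
    ∃ δ : ℝ, 0 < δ ∧ ∃ R : ℝ, ∀ w ∈ halfPlane, ∀ m : ℝ, R ≤ m → 0 ≤ m → m / 2 ≤ w.1 → w.1 ≤ m →
      w.2 ≤ δ * m → ∀ z ∈ halfPlane, |(z.1 : ℝ)| ≤ δ * m → z.2 ≤ δ * m →
      D * expW b 0 (z - w) ≤ ENNReal.ofReal σ * greenHalfPlane ν z w := by
  obtain ⟨K, hK, hlow⟩ := h.exists_le_green
  obtain ⟨D', hD'⟩ := hlow (b / 16) (by positivity)
  obtain ⟨δ, hδ, hδ1, hδ2⟩ : ∃ δ : ℝ, 0 < δ ∧ δ ≤ 1 / 2 ∧ δ * (b + 2 * K) ≤ b / 8 := by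
    refine ⟨min (1 / 2) (b / 8 / (b + 2 * K)), by positivity, min_le_left _ _, ?_⟩
    rw [← le_div_iff₀ (by positivity)]
    exact min_le_right _ _
  have hlim : Tendsto (fun m : ℝ => D * ENNReal.ofReal (Real.exp (D' + -(b / 4) * m))) atTop
      (𝓝 0) := by
    have h1 : Tendsto (fun m : ℝ => Real.exp (D' + -(b / 4) * m)) atTop (𝓝 0) := by
      refine Real.tendsto_exp_atBot.comp (tendsto_atBot_add_const_left _ _ ?_)
      exact Tendsto.const_mul_atTop_of_neg (by linarith) tendsto_id
    have := ENNReal.Tendsto.const_mul (ENNReal.tendsto_ofReal h1) (a := D) (Or.inr hD)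
    simpa using this
  obtain ⟨R, hR⟩ := eventually_atTop.1
    (hlim.eventually (gt_mem_nhds (ENNReal.ofReal_pos.2 hσ)))
  refine ⟨δ, hδ, R, fun w hw m hm hm0 hw1 hw1' hw2 z hz hz1 hz2 => ?_⟩
  obtain ⟨hz1a, hz1b⟩ := abs_le.1 hz1
  have hδm : δ * m ≤ m / 2 := by nlinarith
  have hzw : z.1 ≤ w.1 := by
    have : (z.1 : ℝ) ≤ w.1 := by linarith
    exact_mod_cast this
  have h1 := hD' z hz w hw hzw
  set E := D' + b / 16 * ((w.1 : ℝ) - z.1) + K * ((z.2 : ℝ) + w.2) with hE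
  have hexp : expW b 0 (z - w) * ENNReal.ofReal (Real.exp E) ≤
      ENNReal.ofReal (Real.exp (D' + -(b / 4) * m)) := by
    rw [expW, ← ENNReal.ofReal_mul (Real.exp_nonneg _), ← Real.exp_add]
    refine ENNReal.ofReal_le_ofReal (Real.exp_le_exp.2 ?_)
    push_cast [Prod.fst_sub]
    rw [hE]
    have e1 : K * ((z.2 : ℝ) + w.2) ≤ K * (2 * (δ * m)) := by gcongr; linarith
    have e2 : b * (z.1 : ℝ) ≤ b * (δ * m) := by gcongr
    have e3 : b * (m / 2) ≤ b * w.1 := by gcongr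
    have e4 : δ * (b + 2 * K) * m ≤ b / 8 * m := by gcongr
    have e5 : b / 16 * ((w.1 : ℝ) - z.1) ≤ b / 16 * (2 * m) := by gcongr; linarith
    nlinarith
  calc D * expW b 0 (z - w) ≤ D * expW b 0 (z - w) *
        (ENNReal.ofReal (Real.exp E) * greenHalfPlane ν z w) := le_mul_of_one_le_right' h1
    _ = D * (expW b 0 (z - w) * ENNReal.ofReal (Real.exp E)) * greenHalfPlane ν z w := by ring
    _ ≤ D * ENNReal.ofReal (Real.exp (D' + -(b / 4) * m)) * greenHalfPlane ν z w := by gcongr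
    _ ≤ _ := by
      gcongr
      exact (hR m hm).le

/-- Horizontal ratio bound: moving the starting point by `(±1, 0)` changes the Green function by
a factor close to one, uniformly for starting points much closer to the origin than the target. -/
lemma HorizontalDrift.exists_horizontal_ratio {ν : PMF (ℤ × ℤ)} {c C : ℝ}
    (h : HorizontalDrift ν c C) {σ : ℝ} (hσ : 0 < σ) :
    ∃ δ : ℝ, 0 < δ ∧ ∃ R : ℝ, ∀ w ∈ halfPlane, ∀ m : ℝ, R ≤ m → 0 ≤ m → m / 2 ≤ w.1 → w.1 ≤ m →
      w.2 ≤ δ * m → ∀ y : ℤ, 0 < y → y ≤ δ * m → ∀ x x' : ℤ, |(x : ℝ)| ≤ δ * m →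
      |(x' : ℝ)| ≤ δ * m → greenHalfPlane ν (x', y) w ≤
        ENNReal.ofReal (Real.exp (σ * |(x' : ℝ) - x|)) * greenHalfPlane ν (x, y) w := by
  obtain ⟨b₁, hb₁, D₁, hD₁, h₁⟩ := h.green_shift_le (half_pos hσ)
  obtain ⟨b₂, hb₂, D₂, hD₂, h₂⟩ := h.green_le_shift (half_pos hσ)
  obtain ⟨δ₁, hδ₁, R₁, e₁⟩ := h.error_le hb₁ (half_pos hσ) hD₁
  obtain ⟨δ₂, hδ₂, R₂, e₂⟩ := h.error_le hb₂ (half_pos hσ) hD₂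
  refine ⟨min δ₁ δ₂, by positivity, max R₁ R₂,
    fun w hw m hm hm0 hw1 hw1' hw2 y hy hym x x' hx hx' => ?_⟩
  have hle₁ : min δ₁ δ₂ * m ≤ δ₁ * m := by gcongr; exact min_le_left _ _
  have hle₂ : min δ₁ δ₂ * m ≤ δ₂ * m := by gcongr; exact min_le_right _ _
  have hfac : ENNReal.ofReal (1 + σ / 2) + ENNReal.ofReal (σ / 2) ≤
      ENNReal.ofReal (Real.exp σ) := by
    rw [← ENNReal.ofReal_add (by positivity) (by positivity)]
    refine ENNReal.ofReal_le_ofReal ?_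
    linarith [Real.add_one_le_exp σ]
  have hmem : ∀ x : ℤ, (x, y) ∈ halfPlane := fun x => hy
  have hadd : ∀ x : ℤ, ((x, y) : ℤ × ℤ) + (1, 0) = (x + 1, y) := fun x => by simp
  have fwd : ∀ x : ℤ, |(x : ℝ)| ≤ min δ₁ δ₂ * m → greenHalfPlane ν (x + 1, y) w ≤
      ENNReal.ofReal (Real.exp σ) * greenHalfPlane ν (x, y) w := by
    intro x hx
    have a1 := h₁ (x, y) (hmem x) w
    have a2 := e₁ w hw m ((le_max_left _ _).trans hm) hm0 hw1 hw1' (hw2.trans hle₁) (x, y) (hmem x)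
      (hx.trans hle₁) (hym.trans hle₁)
    rw [hadd] at a1
    refine a1.trans ((add_le_add_right a2 _).trans ?_)
    rw [← add_mul]
    gcongr
  have bwd : ∀ x : ℤ, |((x + 1 : ℤ) : ℝ)| ≤ min δ₁ δ₂ * m → greenHalfPlane ν (x, y) w ≤
      ENNReal.ofReal (Real.exp σ) * greenHalfPlane ν (x + 1, y) w := by
    intro x hx
    have a1 := h₂ (x, y) (hmem x) w
    have a2 := e₂ w hw m ((le_max_right _ _).trans hm) hm0 hw1 hw1' (hw2.trans hle₂) (x + 1, y)
      (hmem _) (hx.trans hle₂) (hym.trans hle₂)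
    rw [hadd] at a1
    have a3 : D₂ * expW b₂ 0 ((x, y) - w) ≤ D₂ * expW b₂ 0 ((x + 1, y) - w) := by
      refine mul_le_mul_right (ENNReal.ofReal_le_ofReal (Real.exp_le_exp.2 ?_)) _
      push_cast [Prod.fst_sub]
      nlinarith
    refine a1.trans ((add_le_add_right (a3.trans a2) _).trans ?_)
    rw [← add_mul]
    gcongr
  obtain ⟨hxa, hxb⟩ := abs_le.1 hx
  obtain ⟨hxa', hxb'⟩ := abs_le.1 hx'
  rcases le_total x x' with hxx | hxx
  · obtain ⟨N, hN⟩ := Int.eq_ofNat_of_zero_le (sub_nonneg.2 hxx)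
    have key := le_exp_mul_of_step (g := fun k : ℕ => greenHalfPlane ν (x + k, y) w) (K := σ)
      (N := N) fun k hk => by
        have hk' : ((x + k : ℤ) : ℝ) ≤ x' := by
          have : x + k ≤ x' := by omega
          exact_mod_cast this
        have := fwd (x + k) (abs_le.2 ⟨by push_cast; linarith [(Nat.cast_nonneg k : (0:ℝ) ≤ k)],
          by linarith⟩)
        simpa [add_assoc] using this
    have hx' : x' = x + N := by omega
    subst hx'
    simpa using key
  · obtain ⟨N, hN⟩ := Int.eq_ofNat_of_zero_le (sub_nonneg.2 hxx)
    have key := le_exp_mul_of_step (g := fun k : ℕ => greenHalfPlane ν (x - k, y) w) (K := σ)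
      (N := N) fun k hk => by
        have hk' : (x' : ℝ) ≤ ((x - (k + 1 : ℕ) + 1 : ℤ) : ℝ) := by
          have : x' ≤ x - (k + 1 : ℕ) + 1 := by omega
          exact_mod_cast this
        have hk'' : ((x - (k + 1 : ℕ) + 1 : ℤ) : ℝ) ≤ x := by
          have : x - (k + 1 : ℕ) + 1 ≤ x := by omega
          exact_mod_cast this
        have := bwd (x - (k + 1 : ℕ)) (abs_le.2 ⟨by linarith, by linarith⟩)
        rwa [show x - ((k + 1 : ℕ) : ℤ) + 1 = x - k by push_cast; ring] at this
    have hx' : x' = x - N := by omega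
    subst hx'
    simpa using key

/-- The ratio bound for the walk with drift in the direction `(1, 0)`. -/
lemma HorizontalDrift.exists_green_le_mul {ν : PMF (ℤ × ℤ)} {c C : ℝ} (h : HorizontalDrift ν c C)
    {z₀ : ℤ × ℤ} (hz₀ : z₀ ∈ halfPlane) {σ : ℝ} (hσ : 0 < σ) :
    ∃ A : ℝ, ∃ δ : ℝ, 0 < δ ∧ ∃ R : ℝ, ∀ w ∈ halfPlane, ∀ m : ℝ, R ≤ m → 0 ≤ m → m / 2 ≤ w.1 →
      w.1 ≤ m → w.2 ≤ δ * m → ∀ z ∈ halfPlane, |(z.1 : ℝ)| ≤ δ * m → z.2 ≤ δ * m →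
      greenHalfPlane ν z w ≤
        ENNReal.ofReal (Real.exp (A + σ * |(z.1 : ℝ)| + σ * z.2)) * greenHalfPlane ν z₀ w := by
  obtain ⟨K, hK, hh⟩ := harnack h.irreducible
  obtain ⟨n, L, hL, hclimb⟩ := h.exists_climb (half_pos hσ)
  rw [ENNReal.tsum_eq_iSup_sum] at hclimb
  obtain ⟨J, hJ⟩ := lt_iSup_iff.1 hclimb
  obtain ⟨M, hM⟩ : ∃ M : ℕ, ∀ j ∈ J, |(j : ℝ)| ≤ M := by
    refine ⟨J.sup Int.natAbs, fun j hj => ?_⟩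
    rw [← Int.cast_abs, Int.abs_eq_natAbs]
    exact_mod_cast Finset.le_sup (f := Int.natAbs) hj
  have hM0 : (0 : ℝ) ≤ M := by positivity
  have hL' : (1 : ℝ) ≤ L := by exact_mod_cast hL
  -- a horizontal displacement of at most `M` costs less than `σ / 2`
  obtain ⟨σ₁, hσ₁, hσ₁M, hσ₁σ⟩ : ∃ σ₁ : ℝ, 0 < σ₁ ∧ σ₁ * M ≤ σ / 2 ∧ σ₁ ≤ σ := by
    refine ⟨σ / 2 / (M + 1), by positivity, ?_, ?_⟩
    · rw [div_mul_eq_mul_div, div_le_iff₀ (by positivity)]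
      nlinarith
    · rw [div_le_iff₀ (by positivity)]
      nlinarith
  obtain ⟨δ, hδ, R, hratio⟩ := h.exists_horizontal_ratio hσ₁
  refine ⟨σ₁ * |(z₀.1 : ℝ)| + K * L + K * z₀.2, δ / 2, by positivity,
    max R (max (M / (δ / 2)) (|(z₀.1 : ℝ)| / δ)), ?_⟩
  intro w hw m hm hm0 hw1 hw1' hw2 z hz hz1 hz2
  have hRm : R ≤ m := (le_max_left _ _).trans hm
  have hMm : M ≤ δ / 2 * m := by
    have := ((le_max_left _ _).trans (le_max_right _ _)).trans hm
    rw [div_le_iff₀ (by positivity)] at this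
    linarith
  have hz0m : |(z₀.1 : ℝ)| ≤ δ * m := by
    have := ((le_max_right _ _).trans (le_max_right _ _)).trans hm
    rw [div_le_iff₀ (by positivity)] at this
    linarith
  have hδm : δ / 2 * m ≤ δ * m := by nlinarith
  have hor := hratio w hw m hRm hm0 hw1 hw1' (hw2.trans hδm)
  have hz0 : 0 < z.2 := hz
  have hz₀0 : 0 < z₀.2 := hz₀
  -- one climb of `L` levels
  have climb : ∀ y : ℤ, 0 < y → ((y + L : ℤ) : ℝ) ≤ δ * m → greenHalfPlane ν (z.1, y + L) w ≤
      ENNReal.ofReal (Real.exp (σ * L)) * greenHalfPlane ν (z.1, y) w := by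
    intro y hy hym
    have h1 : ∀ j ∈ J, greenHalfPlane ν (z.1, y + L) w ≤
        ENNReal.ofReal (Real.exp (σ / 2)) * greenHalfPlane ν (z.1 + j, y + L) w := by
      intro j hj
      have hj' : |((z.1 + j : ℤ) : ℝ)| ≤ δ * m := by
        push_cast
        refine (abs_add_le _ _).trans ?_
        linarith [hM j hj]
      refine (hor (y + L) (by omega) hym (z.1 + j) z.1 hj' (hz1.trans hδm)).trans ?_
      refine mul_le_mul_left (ENNReal.ofReal_le_ofReal (Real.exp_le_exp.2 ?_)) _
      push_cast
      rw [show (z.1 : ℝ) - (z.1 + j) = -j by ring, abs_neg]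
      exact (mul_le_mul_of_nonneg_left (hM j hj) hσ₁.le).trans hσ₁M
    have h2 : ∑ j ∈ J, nStep (killedKernel ν halfPlane) n (0, 1) (j, 1 + L) *
        greenHalfPlane ν (z.1 + j, y + L) w ≤ greenHalfPlane ν (z.1, y) w := by
      refine le_trans ?_ (tsum_nStep_mul_green_le _ n (z.1, y) w)
      refine le_trans ?_ (ENNReal.tsum_comp_le_tsum_of_injective
        (f := fun j : ℤ => (z.1 + j, y + (L : ℤ)))
        (fun a b hab => by simpa using hab) _)
      refine le_trans (Finset.sum_le_sum fun j _ => ?_) (ENNReal.sum_le_tsum J)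
      refine mul_le_mul_left ?_ _
      have := nStep_killedKernel_le_translate ν (v := (z.1, y - 1)) (by simp; omega) n (0, 1)
        (j, 1 + L)
      refine this.trans (le_of_eq ?_)
      congr 1
      · ext <;> simp
      · refine Prod.ext ?_ ?_ <;> simp <;> ring
    calc greenHalfPlane ν (z.1, y + L) w
        = ENNReal.ofReal (Real.exp (σ / 2 * L)) * (ENNReal.ofReal (Real.exp (-(σ / 2 * L))) *
            greenHalfPlane ν (z.1, y + L) w) := by
          rw [← mul_assoc, ← ENNReal.ofReal_mul (Real.exp_nonneg _), ← Real.exp_add]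
          simp
      _ ≤ ENNReal.ofReal (Real.exp (σ / 2 * L)) *
          ((∑ j ∈ J, nStep (killedKernel ν halfPlane) n (0, 1) (j, 1 + L)) *
            greenHalfPlane ν (z.1, y + L) w) := by gcongr
      _ ≤ ENNReal.ofReal (Real.exp (σ / 2 * L)) *
          (ENNReal.ofReal (Real.exp (σ / 2)) * greenHalfPlane ν (z.1, y) w) := by
          refine mul_le_mul_right (le_trans ?_ (mul_le_mul_right h2 _)) _
          rw [Finset.sum_mul, Finset.mul_sum]
          refine Finset.sum_le_sum fun j hj => ?_
          rw [mul_left_comm]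
          exact mul_le_mul_right (h1 j hj) _
      _ ≤ _ := by
          rw [← mul_assoc, ← ENNReal.ofReal_mul (Real.exp_nonneg _), ← Real.exp_add]
          refine mul_le_mul_left (ENNReal.ofReal_le_ofReal (Real.exp_le_exp.2 ?_)) _
          nlinarith
  -- descend from `z` to a point of height at most `L`
  obtain ⟨k, r, hr, hrL, hkr⟩ : ∃ k r : ℕ, 1 ≤ r ∧ r ≤ L ∧ z.2 = r + k * L := by
    obtain ⟨d, hd⟩ := Int.eq_ofNat_of_zero_le (show 0 ≤ z.2 - 1 by omega)
    refine ⟨d / L, d % L + 1, by omega, Nat.mod_lt _ hL, ?_⟩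
    have h1 : (L : ℤ) * (d / L : ℕ) + (d % L : ℕ) = d := by exact_mod_cast Nat.div_add_mod d L
    push_cast at h1 ⊢
    linarith
  have hkr' : (z.2 : ℝ) = r + k * L := by exact_mod_cast hkr
  have s1 := le_exp_mul_of_step (g := fun i : ℕ => greenHalfPlane ν (z.1, (r : ℤ) + i * L) w)
    (K := σ * L) (N := k) fun i hi => by
      have hik : ((i : ℝ) + 1) * L ≤ k * L := by
        gcongr
        exact_mod_cast hi
      have := climb (r + i * L) (by positivity) (by push_cast; linarith)
      rwa [show (r : ℤ) + i * L + L = r + ((i + 1 : ℕ) : ℤ) * L by push_cast; ring] at this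
  simp only [← hkr, Nat.cast_zero, zero_mul, add_zero] at s1
  have hone : ∀ x : ℤ, (x, (1 : ℤ)) ∈ halfPlane := fun x => by simp [halfPlane]
  have hr1 : (1 : ℝ) ≤ r := by exact_mod_cast hr
  have hrL' : (r : ℝ) ≤ L := by exact_mod_cast hrL
  have s2 := hh (z.1, 1) (hone _) (z.1, r) (by simp [halfPlane]; omega) w
  have hone_le : ((1 : ℤ) : ℝ) ≤ δ * m := by
    have : (1 : ℝ) ≤ z.2 := by exact_mod_cast hz0
    push_cast
    linarith
  have s3 := hor 1 one_pos hone_le z₀.1 z.1 hz0m (hz1.trans hδm)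
  have s4 := hh z₀ hz₀ (z₀.1, 1) (hone _) w
  refine s1.trans ((mul_le_mul_right (s2.trans (mul_le_mul_right (s3.trans
    (mul_le_mul_right s4 _)) _)) _).trans ?_)
  rw [← mul_assoc, ← mul_assoc, ← mul_assoc, ← ENNReal.ofReal_mul (by positivity),
    ← ENNReal.ofReal_mul (by positivity), ← ENNReal.ofReal_mul (by positivity), ← Real.exp_add,
    ← Real.exp_add, ← Real.exp_add]
  refine mul_le_mul_left (ENNReal.ofReal_le_ofReal (Real.exp_le_exp.2 ?_)) _
  have hz₀1 : (1 : ℝ) ≤ z₀.2 := by exact_mod_cast hz₀0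
  simp only [sub_self, abs_zero, zero_add, Int.cast_one, Int.cast_natCast]
  rw [abs_of_nonneg (by linarith : (0 : ℝ) ≤ r - 1),
    abs_of_nonpos (by linarith : (1 : ℝ) - z₀.2 ≤ 0)]
  have t1 : σ₁ * |(z.1 : ℝ) - z₀.1| ≤ σ * |(z.1 : ℝ)| + σ₁ * |(z₀.1 : ℝ)| := by
    calc σ₁ * |(z.1 : ℝ) - z₀.1| ≤ σ₁ * (|(z.1 : ℝ)| + |(z₀.1 : ℝ)|) := by
          gcongr; exact abs_sub _ _
      _ ≤ _ := by rw [mul_add]; gcongr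
  have t2 : K * (r - 1) ≤ K * L := by gcongr; linarith
  have t3 : σ * L * k ≤ σ * z.2 := by
    rw [hkr', mul_assoc, mul_comm (L : ℝ)]
    gcongr
    linarith
  nlinarith


/-! ### The jump generating function -/

section JumpGen

variable {μ : PMF (ℤ × ℤ)}

lemma inner_toPlane (a : EuclideanSpace ℝ (Fin 2)) (z : ℤ × ℤ) :
    inner ℝ a (toPlane z) = a 0 * z.1 + a 1 * z.2 := by
  simp [PiLp.inner_apply, Fin.sum_univ_two, toPlane, mul_comm]

lemma abs_fst_le_norm_toPlane (z : ℤ × ℤ) : |(z.1 : ℝ)| ≤ ‖toPlane z‖ := by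
  simpa [toPlane] using PiLp.norm_apply_le (toPlane z) 0

lemma abs_snd_le_norm_toPlane (z : ℤ × ℤ) : |(z.2 : ℝ)| ≤ ‖toPlane z‖ := by
  simpa [toPlane] using PiLp.norm_apply_le (toPlane z) 1

lemma norm_toPlane_le (z : ℤ × ℤ) : ‖toPlane z‖ ≤ |(z.1 : ℝ)| + |(z.2 : ℝ)| := by
  rw [EuclideanSpace.norm_eq, Fin.sum_univ_two]
  refine Real.sqrt_le_iff.2 ⟨by positivity, ?_⟩
  simp only [toPlane, Real.norm_eq_abs, sq_abs, PiLp.toLp_apply, Matrix.cons_val_zero,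
    Matrix.cons_val_one]
  nlinarith [abs_nonneg (z.1 : ℝ), abs_nonneg (z.2 : ℝ), sq_abs (z.1 : ℝ), sq_abs (z.2 : ℝ),
    mul_nonneg (abs_nonneg (z.1 : ℝ)) (abs_nonneg (z.2 : ℝ))]

lemma expTerm_nonneg (μ : PMF (ℤ × ℤ)) (a : EuclideanSpace ℝ (Fin 2)) (z : ℤ × ℤ) :
    0 ≤ expTerm μ a z := mul_nonneg ENNReal.toReal_nonneg (Real.exp_nonneg _)

lemma expTerm_add (μ : PMF (ℤ × ℤ)) (a h : EuclideanSpace ℝ (Fin 2)) (z : ℤ × ℤ) :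
    expTerm μ (a + h) z = expTerm μ a z * Real.exp (inner ℝ h (toPlane z)) := by
  rw [expTerm, expTerm, inner_add_left, Real.exp_add, mul_assoc]

lemma summable_expTerm_mul_exp_norm (hexp : ∀ a, Summable (expTerm μ a))
    (a : EuclideanSpace ℝ (Fin 2)) {K : ℝ} (hK : 0 ≤ K) :
    Summable fun z => expTerm μ a z * Real.exp (K * ‖toPlane z‖) := by
  have h := (((hexp (a + !₂[K, K])).add (hexp (a + !₂[K, -K]))).add
    (hexp (a + !₂[-K, K]))).add (hexp (a + !₂[-K, -K]))
  refine h.of_nonneg_of_le (fun z => mul_nonneg (expTerm_nonneg _ _ _) (Real.exp_nonneg _))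
    fun z => ?_
  rw [expTerm_add, expTerm_add, expTerm_add, expTerm_add, ← mul_add, ← mul_add, ← mul_add]
  refine mul_le_mul_of_nonneg_left ?_ (expTerm_nonneg _ _ _)
  simp only [inner_toPlane, Matrix.cons_val_zero, Matrix.cons_val_one]
  have key : ∀ x : ℝ, Real.exp (K * |x|) ≤ Real.exp (K * x) + Real.exp (-K * x) := by
    intro x
    rcases abs_cases x with ⟨h, _⟩ | ⟨h, _⟩
    · rw [h]; linarith [Real.exp_pos (-K * x)]
    · rw [h, mul_neg, ← neg_mul]; linarith [Real.exp_pos (K * x)]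
  calc Real.exp (K * ‖toPlane z‖) ≤ Real.exp (K * |(z.1 : ℝ)|) * Real.exp (K * |(z.2 : ℝ)|) := by
        rw [← Real.exp_add, ← mul_add]
        exact Real.exp_le_exp.2 (mul_le_mul_of_nonneg_left (norm_toPlane_le z) hK)
    _ ≤ (Real.exp (K * z.1) + Real.exp (-K * z.1)) *
        (Real.exp (K * z.2) + Real.exp (-K * z.2)) :=
        mul_le_mul (key _) (key _) (Real.exp_nonneg _) (by positivity)
    _ = _ := by
        simp only [Real.exp_add]
        ring

/-- The gradient `∑ z, μ(z) exp(a · z) z` of the jump generating function. -/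
def jumpGrad (μ : PMF (ℤ × ℤ)) (a : EuclideanSpace ℝ (Fin 2)) : EuclideanSpace ℝ (Fin 2) :=
  ∑' z, expTerm μ a z • toPlane z

lemma jumpGrad_zero (μ : PMF (ℤ × ℤ)) : jumpGrad μ 0 = meanJump μ := by
  simp [jumpGrad, meanJump, expTerm]

lemma summable_expTerm_smul (hexp : ∀ a, Summable (expTerm μ a))
    (a : EuclideanSpace ℝ (Fin 2)) : Summable fun z => expTerm μ a z • toPlane z := by
  refine Summable.of_norm_bounded (summable_expTerm_mul_exp_norm hexp a zero_le_one) fun z => ?_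
  rw [norm_smul, Real.norm_of_nonneg (expTerm_nonneg _ _ _), one_mul]
  refine mul_le_mul_of_nonneg_left ?_ (expTerm_nonneg _ _ _)
  linarith [Real.add_one_le_exp ‖toPlane z‖]

lemma hasSum_expTerm_mul_inner (hexp : ∀ a, Summable (expTerm μ a))
    (a h : EuclideanSpace ℝ (Fin 2)) :
    HasSum (fun z => expTerm μ a z * inner ℝ h (toPlane z)) (inner ℝ h (jumpGrad μ a)) := by
  have := (innerSL ℝ h).hasSum (summable_expTerm_smul hexp a).hasSum
  simpa [inner_smul_right, jumpGrad, Function.comp_def] using this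

/-- Convexity of the jump generating function. -/
lemma jumpGen_add_inner_le (hexp : ∀ a, Summable (expTerm μ a))
    (a h : EuclideanSpace ℝ (Fin 2)) :
    jumpGen μ a + inner ℝ h (jumpGrad μ a) ≤ jumpGen μ (a + h) := by
  refine hasSum_le (fun z => ?_) ((hexp a).hasSum.add (hasSum_expTerm_mul_inner hexp a h))
    (hexp (a + h)).hasSum
  rw [expTerm_add]
  have := mul_le_mul_of_nonneg_left (Real.add_one_le_exp (inner ℝ h (toPlane z)))
    (expTerm_nonneg μ a z)
  linarith

lemma abs_exp_sub_one_sub_le (u : ℝ) : |Real.exp u - 1 - u| ≤ u ^ 2 * Real.exp |u| := by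
  have h := Complex.norm_exp_sub_sum_le_norm_mul_exp (u : ℂ) 2
  rw [show Complex.exp u - ∑ m ∈ Finset.range 2, (u : ℂ) ^ m / m.factorial =
    ((Real.exp u - 1 - u : ℝ) : ℂ) by simp [Finset.sum_range_succ]; ring] at h
  simpa [Complex.norm_real, ← Complex.ofReal_exp, -Complex.ofReal_sub] using h

/-- First order expansion of the jump generating function, with a quadratic remainder. -/
lemma exists_jumpGen_remainder (hexp : ∀ a, Summable (expTerm μ a))
    (a : EuclideanSpace ℝ (Fin 2)) : ∃ C : ℝ, 0 ≤ C ∧ ∀ h : EuclideanSpace ℝ (Fin 2), ‖h‖ ≤ 2 →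
      |jumpGen μ (a + h) - jumpGen μ a - inner ℝ h (jumpGrad μ a)| ≤ C * ‖h‖ ^ 2 := by
  have hs := summable_expTerm_mul_exp_norm hexp a (K := 3) (by norm_num)
  refine ⟨2 * ∑' z, expTerm μ a z * Real.exp (3 * ‖toPlane z‖), ?_, fun h hh => ?_⟩
  · have : 0 ≤ ∑' z, expTerm μ a z * Real.exp (3 * ‖toPlane z‖) :=
      tsum_nonneg fun z => mul_nonneg (expTerm_nonneg _ _ _) (Real.exp_nonneg _)
    positivity
  have h1 := ((hexp (a + h)).hasSum.sub (hexp a).hasSum).sub (hasSum_expTerm_mul_inner hexp a h)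
  have hpt : ∀ z, ‖expTerm μ (a + h) z - expTerm μ a z - expTerm μ a z * inner ℝ h (toPlane z)‖ ≤
      expTerm μ a z * Real.exp (3 * ‖toPlane z‖) * (2 * ‖h‖ ^ 2) := by
    intro z
    rw [expTerm_add, show expTerm μ a z * Real.exp (inner ℝ h (toPlane z)) - expTerm μ a z -
      expTerm μ a z * inner ℝ h (toPlane z) = expTerm μ a z *
      (Real.exp (inner ℝ h (toPlane z)) - 1 - inner ℝ h (toPlane z)) by ring, norm_mul,
      Real.norm_of_nonneg (expTerm_nonneg _ _ _), Real.norm_eq_abs, mul_assoc]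
    refine mul_le_mul_of_nonneg_left ?_ (expTerm_nonneg _ _ _)
    refine (abs_exp_sub_one_sub_le _).trans ?_
    have hin := abs_real_inner_le_norm h (toPlane z)
    have hn := norm_nonneg (toPlane z)
    have hin2 : |inner ℝ h (toPlane z)| ≤ 2 * ‖toPlane z‖ := hin.trans (by gcongr)
    have hsq : inner ℝ h (toPlane z) ^ 2 ≤ ‖h‖ ^ 2 * ‖toPlane z‖ ^ 2 := by
      rw [← mul_pow, ← sq_abs]
      gcongr
    have hq : ‖toPlane z‖ ^ 2 ≤ 2 * Real.exp ‖toPlane z‖ := by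
      have := Real.quadratic_le_exp_of_nonneg hn
      nlinarith
    calc inner ℝ h (toPlane z) ^ 2 * Real.exp |inner ℝ h (toPlane z)|
        ≤ ‖h‖ ^ 2 * (2 * Real.exp ‖toPlane z‖) * Real.exp (2 * ‖toPlane z‖) := by
          gcongr
          exact hsq.trans (by gcongr)
      _ = Real.exp (3 * ‖toPlane z‖) * (2 * ‖h‖ ^ 2) := by
          rw [show 3 * ‖toPlane z‖ = ‖toPlane z‖ + 2 * ‖toPlane z‖ by ring, Real.exp_add]
          ring
  have h2 := tsum_of_norm_bounded (hs.mul_right (2 * ‖h‖ ^ 2)).hasSum hpt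
  rw [h1.tsum_eq, tsum_mul_right, Real.norm_eq_abs] at h2
  refine h2.trans (le_of_eq ?_)
  ring

lemma hasGradientAt_jumpGen (hexp : ∀ a, Summable (expTerm μ a))
    (a : EuclideanSpace ℝ (Fin 2)) : HasGradientAt (jumpGen μ) (jumpGrad μ a) a := by
  obtain ⟨C, hC, h⟩ := exists_jumpGen_remainder hexp a
  rw [hasGradientAt_iff_isLittleO]
  refine Asymptotics.IsBigO.trans_isLittleO (Asymptotics.IsBigO.of_bound C ?_)
    (Asymptotics.isLittleO_pow_sub_sub a one_lt_two)
  filter_upwards [Metric.closedBall_mem_nhds a two_pos] with x hx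
  have := h (x - a) (by simpa [dist_eq_norm] using hx)
  rw [add_sub_cancel] at this
  simpa [real_inner_comm] using this

lemma continuous_jumpGen (hexp : ∀ a, Summable (expTerm μ a)) : Continuous (jumpGen μ) :=
  continuous_iff_continuousAt.2 fun a => (hasGradientAt_jumpGen hexp a).continuousAt

/-- The generating function decreases in the directions opposite to the gradient. -/
lemma exists_jumpGen_add_smul_lt (hexp : ∀ a, Summable (expTerm μ a))
    {a h : EuclideanSpace ℝ (Fin 2)} (hh : inner ℝ h (jumpGrad μ a) < 0) :
    ∃ t : ℝ, 0 < t ∧ jumpGen μ (a + t • h) < jumpGen μ a := by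
  obtain ⟨C, hC, hr⟩ := exists_jumpGen_remainder hexp a
  set d := -inner ℝ h (jumpGrad μ a) with hd
  have hd0 : 0 < d := by linarith
  have hn := norm_nonneg h
  refine ⟨min (2 / (‖h‖ + 1)) (d / (2 * (C * ‖h‖ ^ 2 + 1))), by positivity, ?_⟩
  set t := min (2 / (‖h‖ + 1)) (d / (2 * (C * ‖h‖ ^ 2 + 1))) with ht
  have ht0 : 0 < t := by positivity
  have ht1 : t * (‖h‖ + 1) ≤ 2 := by
    rw [← le_div_iff₀ (by positivity)]; exact min_le_left _ _
  have ht2 : t * (2 * (C * ‖h‖ ^ 2 + 1)) ≤ d := by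
    rw [← le_div_iff₀ (by positivity)]; exact min_le_right _ _
  have hnt : ‖t • h‖ = t * ‖h‖ := by rw [norm_smul, Real.norm_of_nonneg ht0.le]
  have := hr (t • h) (by rw [hnt]; nlinarith)
  rw [real_inner_smul_left, hnt] at this
  have h1 := (abs_le.1 this).2
  have h2 : t * (t * (2 * (C * ‖h‖ ^ 2 + 1))) ≤ t * d := by gcongr
  nlinarith [mul_pos ht0 ht0, mul_pos ht0 hd0]

lemma toReal_mul_exp_eq (μ : PMF (ℤ × ℤ)) (a : EuclideanSpace ℝ (Fin 2)) (z : ℤ × ℤ) :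
    μ z * expW (a 0) (a 1) z = ENNReal.ofReal (expTerm μ a z) := by
  rw [expTerm, inner_toPlane, ENNReal.ofReal_mul ENNReal.toReal_nonneg,
    ENNReal.ofReal_toReal (μ.apply_ne_top z), expW]

lemma genFun_eq (hexp : ∀ a, Summable (expTerm μ a)) (a : EuclideanSpace ℝ (Fin 2)) :
    genFun μ (a 0) (a 1) = ENNReal.ofReal (jumpGen μ a) := by
  rw [jumpGen, ENNReal.ofReal_tsum_of_nonneg (expTerm_nonneg μ a) (hexp a), genFun]
  exact tsum_congr fun z => toReal_mul_exp_eq μ a z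

lemma jumpGen_zero (μ : PMF (ℤ × ℤ)) : jumpGen μ 0 = 1 := by
  have h := μ.tsum_coe
  have := congrArg ENNReal.toReal h
  rw [ENNReal.tsum_toReal_eq fun z => μ.apply_ne_top z] at this
  simpa [jumpGen, expTerm] using this

lemma exists_jumpGen_lt_one (hexp : ∀ a, Summable (expTerm μ a)) (hmean : meanJump μ ≠ 0) :
    ∃ b, jumpGen μ b < 1 := by
  have h : inner ℝ (-meanJump μ) (jumpGrad μ 0) < 0 := by
    rw [jumpGrad_zero, inner_neg_left, real_inner_self_eq_norm_sq]
    have := norm_pos_iff.2 hmean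
    nlinarith
  obtain ⟨t, _, ht⟩ := exists_jumpGen_add_smul_lt hexp h
  exact ⟨_, ht.trans_eq (jumpGen_zero μ)⟩

/-- On `{φ ≤ 1}`, the quantity `a · d` is bounded above for every displacement `d` of the killed
walk. -/
lemma exists_inner_le (hexp : ∀ a, Summable (expTerm μ a))
    (h : IrreducibleOn (killedKernel μ quadrant) quadrant) {d d' : ℤ × ℤ}
    (hd : 0 ≤ d.1 ∧ 0 ≤ d.2) (hd' : 0 ≤ d'.1 ∧ 0 ≤ d'.2) :
    ∃ B : ℝ, ∀ a : EuclideanSpace ℝ (Fin 2), jumpGen μ a ≤ 1 →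
      a 0 * ((d'.1 : ℝ) - d.1) + a 1 * ((d'.2 : ℝ) - d.2) ≤ B := by
  obtain ⟨n, η, hη, hn⟩ := exists_le_nStep h hd hd'
  have hη' : (η)⁻¹ ≠ ⊤ := by simpa using hη
  refine ⟨(η⁻¹).toReal, fun a ha => ?_⟩
  have hg : genFun μ (a 0) (a 1) ≤ 1 := by
    rw [genFun_eq hexp]
    exact ENNReal.ofReal_le_one.2 ha
  have h1 := nStep_mul_expW_le μ halfPlane (a 0) (a 1) n ((0, 1) + d) ((0, 1) + d')
  have h2 : η * expW (a 0) (a 1) ((0, 1) + d') ≤ expW (a 0) (a 1) ((0, 1) + d) :=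
    (mul_le_mul_left (hn (0, 1) (by simp [halfPlane])) _).trans
      (h1.trans (mul_le_of_le_one_left' (pow_le_one' hg n)))
  have h3 : η * expW (a 0) (a 1) (d' - d) ≤ 1 := by
    have hne := expW_ne_zero (a 0) (a 1) ((0, 1) + d)
    have htop := expW_ne_top (a 0) (a 1) ((0, 1) + d)
    rw [show (0, 1) + d' = (d' - d) + ((0, 1) + d) by abel, expW_add, ← mul_assoc] at h2
    rw [← ENNReal.mul_le_mul_iff_left hne htop, one_mul]
    exact h2
  have h4 : expW (a 0) (a 1) (d' - d) ≤ η⁻¹ := by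
    rw [← one_div, ENNReal.le_div_iff_mul_le (Or.inl hη) (Or.inr ENNReal.one_ne_top), mul_comm]
    exact h3
  have h5 := ENNReal.toReal_mono hη' h4
  rw [expW, ENNReal.toReal_ofReal (Real.exp_nonneg _)] at h5
  push_cast [Prod.fst_sub, Prod.snd_sub] at h5
  linarith [Real.add_one_le_exp (a 0 * ((d'.1 : ℝ) - d.1) + a 1 * ((d'.2 : ℝ) - d.2))]

lemma exists_abs_le_of_jumpGen_le_one (hexp : ∀ a, Summable (expTerm μ a))
    (h : IrreducibleOn (killedKernel μ quadrant) quadrant) :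
    ∃ B : ℝ, ∀ a : EuclideanSpace ℝ (Fin 2), jumpGen μ a ≤ 1 → |a 0| ≤ B ∧ |a 1| ≤ B := by
  obtain ⟨B₁, h₁⟩ := exists_inner_le hexp h (d := (0, 0)) (d' := (1, 0)) (by simp) (by simp)
  obtain ⟨B₂, h₂⟩ := exists_inner_le hexp h (d := (1, 0)) (d' := (0, 0)) (by simp) (by simp)
  obtain ⟨B₃, h₃⟩ := exists_inner_le hexp h (d := (0, 0)) (d' := (0, 1)) (by simp) (by simp)
  obtain ⟨B₄, h₄⟩ := exists_inner_le hexp h (d := (0, 1)) (d' := (0, 0)) (by simp) (by simp)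
  refine ⟨|B₁| + |B₂| + |B₃| + |B₄|, fun a ha => ?_⟩
  have e₁ := (h₁ a ha).trans (le_abs_self B₁)
  have e₂ := (h₂ a ha).trans (le_abs_self B₂)
  have e₃ := (h₃ a ha).trans (le_abs_self B₃)
  have e₄ := (h₄ a ha).trans (le_abs_self B₄)
  have p₁ := abs_nonneg B₁
  have p₂ := abs_nonneg B₂
  have p₃ := abs_nonneg B₃
  have p₄ := abs_nonneg B₄
  norm_num at e₁ e₂ e₃ e₄
  exact ⟨abs_le.2 ⟨by linarith, by linarith⟩, abs_le.2 ⟨by linarith, by linarith⟩⟩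

/-- Existence of the point of the curve `φ = 1` with outer normal `(1, 0)`: the point of
`{φ ≤ 1}` with the largest first coordinate. -/
lemma exists_normalDir_eq (hexp : ∀ a, Summable (expTerm μ a)) (hmean : meanJump μ ≠ 0)
    (h : IrreducibleOn (killedKernel μ quadrant) quadrant) :
    ∃ a, jumpGen μ a = 1 ∧ normalDir μ a = !₂[(1 : ℝ), 0] := by
  obtain ⟨b, hb⟩ := exists_jumpGen_lt_one hexp hmean
  obtain ⟨B, hB⟩ := exists_abs_le_of_jumpGen_le_one hexp h
  have hcomp : IsCompact {a | jumpGen μ a ≤ 1} := by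
    refine Metric.isCompact_of_isClosed_isBounded
      (isClosed_le (continuous_jumpGen hexp) continuous_const) ?_
    refine (Metric.isBounded_iff_subset_closedBall 0).2 ⟨B + B, fun a ha => ?_⟩
    obtain ⟨h0, h1⟩ := hB a ha
    rw [mem_closedBall_zero_iff, EuclideanSpace.norm_eq, Fin.sum_univ_two]
    have := abs_nonneg (a 0)
    refine Real.sqrt_le_iff.2 ⟨by linarith, ?_⟩
    simp only [Real.norm_eq_abs]
    nlinarith [abs_nonneg (a 0), abs_nonneg (a 1)]
  obtain ⟨a, ha, hmax⟩ := hcomp.exists_isMaxOn ⟨b, hb.le⟩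
    (f := fun a : EuclideanSpace ℝ (Fin 2) => a 0) (by fun_prop)
  have ha1 : jumpGen μ a = 1 := by
    by_contra hne
    have hlt : jumpGen μ a < 1 := lt_of_le_of_ne ha hne
    have hc : Continuous fun t : ℝ => jumpGen μ (a + t • !₂[(1 : ℝ), 0]) :=
      (continuous_jumpGen hexp).comp (by fun_prop)
    have hev : ∀ᶠ t in 𝓝 (0 : ℝ), jumpGen μ (a + t • !₂[(1 : ℝ), 0]) < 1 :=
      hc.continuousAt.eventually (gt_mem_nhds (by simpa using hlt))
    obtain ⟨t, ht, ht0⟩ :=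
      ((hev.filter_mono nhdsWithin_le_nhds).and (self_mem_nhdsWithin (s := Set.Ioi 0))).exists
    have := hmax (show a + t • !₂[(1 : ℝ), 0] ∈ {a | jumpGen μ a ≤ 1} from ht.le)
    have ht0' : 0 < t := ht0
    simp at this
    linarith
  have hdir : ∀ v : EuclideanSpace ℝ (Fin 2), inner ℝ v (jumpGrad μ a) < 0 → v 0 ≤ 0 := by
    intro v hv
    obtain ⟨t, ht, hlt⟩ := exists_jumpGen_add_smul_lt hexp hv
    have := hmax (show a + t • v ∈ {a | jumpGen μ a ≤ 1} from (hlt.trans_eq ha1).le)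
    simp at this
    by_contra! h0
    nlinarith
  have hne : inner ℝ (b - a) (jumpGrad μ a) < 0 := by
    have := jumpGen_add_inner_le hexp a (b - a)
    rw [add_sub_cancel] at this
    linarith
  set g := jumpGrad μ a with hg
  have hinner : ∀ v : EuclideanSpace ℝ (Fin 2), inner ℝ v g = v 0 * g 0 + v 1 * g 1 := by
    intro v
    simp [PiLp.inner_apply, Fin.sum_univ_two, mul_comm]
  have hg1 : g 1 = 0 := by
    by_contra h1
    have := hdir !₂[1, -(g 0 + 1) / g 1] (by
      rw [hinner]
      simp only [Matrix.cons_val_zero, Matrix.cons_val_one]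
      rw [div_mul_cancel₀ _ h1]
      linarith)
    norm_num at this
  have hg0 : 0 < g 0 := by
    by_contra! h0
    have h0' : g 0 ≠ 0 := by
      intro h0
      rw [hinner, h0, hg1] at hne
      simp at hne
    have := hdir !₂[1, 0] (by
      rw [hinner]
      simpa using lt_of_le_of_ne h0 h0')
    norm_num at this
  refine ⟨a, ha1, ?_⟩
  have hgeq : g = g 0 • !₂[(1 : ℝ), 0] := by
    ext i
    fin_cases i <;> simp [hg1]
  have hone : ‖(!₂[(1 : ℝ), 0] : EuclideanSpace ℝ (Fin 2))‖ = 1 := by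
    simp [EuclideanSpace.norm_eq, Fin.sum_univ_two]
  rw [normalDir, (hasGradientAt_jumpGen hexp a).gradient, ← hg]
  have hnorm : ‖g‖ = g 0 := by
    rw [hgeq, norm_smul, hone]
    simp [abs_of_pos hg0]
  rw [hnorm]
  nth_rw 2 [hgeq]
  rw [smul_smul, inv_mul_cancel₀ hg0.ne', one_smul]

lemma normalPoint_spec (hexp : ∀ a, Summable (expTerm μ a)) (hmean : meanJump μ ≠ 0)
    (h : IrreducibleOn (killedKernel μ quadrant) quadrant) :
    jumpGen μ (normalPoint μ !₂[(1 : ℝ), 0]) = 1 ∧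
      ∃ c : ℝ, 0 < c ∧ jumpGrad μ (normalPoint μ !₂[(1 : ℝ), 0]) = !₂[c, 0] := by
  obtain ⟨a, ha, ha'⟩ := exists_normalDir_eq hexp hmean h
  have hone : ‖(!₂[(1 : ℝ), 0] : EuclideanSpace ℝ (Fin 2))‖ = 1 := by
    simp [EuclideanSpace.norm_eq, Fin.sum_univ_two]
  have hex : ∃ x ∈ {a | jumpGen μ a = 1}, normalDir μ x =
      ‖(!₂[(1 : ℝ), 0] : EuclideanSpace ℝ (Fin 2))‖⁻¹ • !₂[(1 : ℝ), 0] :=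
    ⟨a, ha, by rw [hone, ha', inv_one, one_smul]⟩
  have hmem := Function.invFunOn_mem hex
  have heq := Function.invFunOn_eq hex
  rw [hone, inv_one, one_smul] at heq hmem
  rw [normalPoint, hone, inv_one, one_smul]
  set p := Function.invFunOn (normalDir μ) {a | jumpGen μ a = 1} !₂[(1 : ℝ), 0]
  refine ⟨hmem, ‖jumpGrad μ p‖, ?_, ?_⟩
  · refine norm_pos_iff.2 fun h0 => ?_
    rw [normalDir, (hasGradientAt_jumpGen hexp p).gradient, h0, smul_zero] at heq
    have := congrFun (congrArg (fun v : EuclideanSpace ℝ (Fin 2) => v.ofLp) heq) 0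
    norm_num at this
  · rw [normalDir, (hasGradientAt_jumpGen hexp p).gradient] at heq
    have hp : ‖jumpGrad μ p‖ ≠ 0 := by
      intro h0
      rw [h0, inv_zero, zero_smul] at heq
      have := congrFun (congrArg (fun v : EuclideanSpace ℝ (Fin 2) => v.ofLp) heq) 0
      norm_num at this
    have h2 : jumpGrad μ p = ‖jumpGrad μ p‖ • !₂[(1 : ℝ), 0] := by
      rw [← heq, smul_smul, mul_inv_cancel₀ hp, one_smul]
    rw [h2, norm_smul, hone]
    ext i
    fin_cases i <;> simp

end JumpGen


/-! ### Exponential change of measure -/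

section Tilt

variable {μ : PMF (ℤ × ℤ)}

/-- The jump law `μ(z) exp(a · z)`, for a point `a` of the curve `φ = 1`. -/
def tilt (μ : PMF (ℤ × ℤ)) (a : EuclideanSpace ℝ (Fin 2)) (ha : genFun μ (a 0) (a 1) = 1) :
    PMF (ℤ × ℤ) :=
  ⟨fun z => μ z * expW (a 0) (a 1) z, (ENNReal.summable.hasSum_iff).2 ha⟩

variable {a : EuclideanSpace ℝ (Fin 2)} (ha : genFun μ (a 0) (a 1) = 1)

lemma tilt_apply (z : ℤ × ℤ) : tilt μ a ha z = μ z * expW (a 0) (a 1) z := rfl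

lemma killedKernel_tilt (E : Set (ℤ × ℤ)) (z w : ℤ × ℤ) :
    killedKernel (tilt μ a ha) E z w * expW (a 0) (a 1) z =
      killedKernel μ E z w * expW (a 0) (a 1) w := by
  unfold killedKernel
  split_ifs with h
  · rw [tilt_apply, mul_assoc, ← expW_add, sub_add_cancel]
  · simp

lemma nStep_tilt (E : Set (ℤ × ℤ)) (n : ℕ) (z w : ℤ × ℤ) :
    nStep (killedKernel (tilt μ a ha) E) n z w * expW (a 0) (a 1) z =
      nStep (killedKernel μ E) n z w * expW (a 0) (a 1) w := by
  induction n generalizing z with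
  | zero =>
    by_cases h : w = z
    · rw [h]; simp [nStep]
    · simp [nStep, h]
  | succ n ih =>
    simp only [nStep, ← ENNReal.tsum_mul_right]
    refine tsum_congr fun v => ?_
    rw [mul_right_comm, killedKernel_tilt, mul_assoc, mul_comm (expW _ _ v), ih, mul_assoc]

lemma greenHalfPlane_tilt (z w : ℤ × ℤ) :
    greenHalfPlane (tilt μ a ha) z w * expW (a 0) (a 1) z =
      greenHalfPlane μ z w * expW (a 0) (a 1) w := by
  simp only [greenHalfPlane, green, ← ENNReal.tsum_mul_right, nStep_tilt]

lemma genFun_tilt (s t : ℝ) : genFun (tilt μ a ha) s t = genFun μ (a 0 + s) (a 1 + t) := by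
  refine tsum_congr fun z => ?_
  rw [tilt_apply, mul_assoc, expW_mul_expW]

lemma irreducibleOn_tilt {E : Set (ℤ × ℤ)} (h : IrreducibleOn (killedKernel μ E) E) :
    IrreducibleOn (killedKernel (tilt μ a ha) E) E := by
  intro z hz w hw
  obtain ⟨n, hn⟩ := h z hz w hw
  refine ⟨n, pos_iff_ne_zero.2 fun h0 => ?_⟩
  have := nStep_tilt ha E n z w
  rw [h0, zero_mul] at this
  exact mul_ne_zero hn.ne' (expW_ne_zero _ _ _) this.symm

end Tilt

/-- The vertical jump is not concentrated at `0`: otherwise `φ` would not depend on the second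
coordinate, and `{φ ≤ 1}` would be unbounded. -/
lemma exists_snd_ne_zero {μ : PMF (ℤ × ℤ)} (hexp : ∀ a, Summable (expTerm μ a))
    (h : IrreducibleOn (killedKernel μ quadrant) quadrant) : ∃ z, μ z ≠ 0 ∧ z.2 ≠ 0 := by
  by_contra! hcon
  obtain ⟨B, hB⟩ := exists_abs_le_of_jumpGen_le_one hexp h
  have h1 : jumpGen μ !₂[0, B + 1] = 1 := by
    rw [← jumpGen_zero μ]
    refine tsum_congr fun z => ?_
    by_cases hz : μ z = 0
    · simp [expTerm, hz]
    · simp [expTerm, inner_toPlane, hcon z hz]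
  have : |B + 1| ≤ B := (hB _ h1.le).2
  linarith [le_abs_self (B + 1)]

lemma horizontalDrift_tilt {μ : PMF (ℤ × ℤ)} (hexp : ∀ a, Summable (expTerm μ a))
    (h : IrreducibleOn (killedKernel μ quadrant) quadrant) {a : EuclideanSpace ℝ (Fin 2)}
    (ha : genFun μ (a 0) (a 1) = 1) {c : ℝ} (hc : 0 < c) (hg : jumpGrad μ a = !₂[c, 0]) :
    ∃ C, HorizontalDrift (tilt μ a ha) c C := by
  obtain ⟨C, hC, hr⟩ := exists_jumpGen_remainder hexp a
  have ha1 : jumpGen μ a = 1 := by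
    rwa [genFun_eq hexp, ENNReal.ofReal_eq_one] at ha
  have hgen : ∀ s t : ℝ, genFun (tilt μ a ha) s t = ENNReal.ofReal (jumpGen μ (a + !₂[s, t])) := by
    intro s t
    rw [genFun_tilt, ← genFun_eq hexp]
    simp
  have hin : ∀ s t : ℝ, inner ℝ !₂[s, t] (jumpGrad μ a) = c * s := by
    intro s t
    simp [hg, PiLp.inner_apply, Fin.sum_univ_two]
  refine ⟨C, hc, hC, fun s t hs ht => ?_, fun t ht => ?_, irreducibleOn_tilt ha h⟩
  · rw [hgen]
    refine ENNReal.ofReal_le_ofReal ?_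
    have hn : ‖(!₂[s, t] : EuclideanSpace ℝ (Fin 2))‖ ^ 2 = s ^ 2 + t ^ 2 := by
      rw [EuclideanSpace.norm_sq_eq, Fin.sum_univ_two]
      simp
    have hs2 : s ^ 2 ≤ 1 := (sq_le_one_iff_abs_le_one s).2 hs
    have ht2 : t ^ 2 ≤ 1 := (sq_le_one_iff_abs_le_one t).2 ht
    have := hr !₂[s, t] (abs_le_of_sq_le_sq' (by rw [hn]; linarith) (by norm_num)).2
    rw [hn, hin, ha1] at this
    linarith [(abs_le.1 this).2]
  · rw [hgen, ← ENNReal.ofReal_one]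
    refine (ENNReal.ofReal_lt_ofReal_iff_of_nonneg zero_le_one).2 ?_
    -- the convexity inequality is strict as soon as one jump has a vertical component
    obtain ⟨z, hz, hz2⟩ := exists_snd_ne_zero hexp h
    have h1 := (hexp a).hasSum.add (hasSum_expTerm_mul_inner hexp a !₂[0, t])
    rw [hin, mul_zero, add_zero] at h1
    have h2 : jumpGen μ a < jumpGen μ (a + !₂[0, t]) := by
      refine hasSum_lt (i := z) (fun z => ?_) ?_ h1 (hexp (a + !₂[0, t])).hasSum
      · dsimp only
        rw [expTerm_add]
        have := mul_le_mul_of_nonneg_left (Real.add_one_le_exp (inner ℝ !₂[0, t] (toPlane z)))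
          (expTerm_nonneg μ a z)
        linarith
      · rw [expTerm_add]
        have hpos : 0 < expTerm μ a z :=
          mul_pos (ENNReal.toReal_pos hz (μ.apply_ne_top z)) (Real.exp_pos _)
        have hne : inner ℝ !₂[0, t] (toPlane z) ≠ 0 := by
          rw [inner_toPlane]
          simp [ht.ne', hz2]
        have := mul_lt_mul_of_pos_left (Real.add_one_lt_exp hne) hpos
        linarith
    rwa [ha1] at h2

/-- A point where the generating function is less than one makes the walk transient. -/
lemma greenHalfPlane_lt_top {μ : PMF (ℤ × ℤ)} {s t : ℝ} (h : genFun μ s t < 1) (z w : ℤ × ℤ) :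
    greenHalfPlane μ z w < ⊤ := by
  have h1 : greenHalfPlane μ z w * expW s t w ≤ (1 - genFun μ s t)⁻¹ * expW s t z := by
    rw [greenHalfPlane, green, ← ENNReal.tsum_geometric, ← ENNReal.tsum_mul_right,
      ← ENNReal.tsum_mul_right]
    exact ENNReal.tsum_le_tsum fun n => nStep_mul_expW_le μ halfPlane s t n z w
  have h2 : (1 - genFun μ s t)⁻¹ * expW s t z ≠ ⊤ :=
    ENNReal.mul_ne_top (by simpa using (tsub_pos_of_lt h).ne') (expW_ne_top _ _ _)
  refine lt_top_iff_ne_top.2 fun h0 => ?_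
  rw [h0, ENNReal.top_mul (expW_ne_zero _ _ _)] at h1
  exact h2 (top_le_iff.1 h1)

lemma greenHalfPlane_pos {μ : PMF (ℤ × ℤ)} (h : IrreducibleOn (killedKernel μ quadrant) quadrant)
    {z w : ℤ × ℤ} (hz : z ∈ halfPlane) (hw : w ∈ halfPlane) : 0 < greenHalfPlane μ z w := by
  obtain ⟨K, _, hh⟩ := harnack h
  refine pos_iff_ne_zero.2 fun h0 => ?_
  have := (one_le_green_self _ w).trans (hh z hz w hw w)
  rw [h0, mul_zero] at this
  simp at this

end KilledWalk

end

theorem proposition7p6 (μ : PMF (ℤ × ℤ))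
    (hirr : KilledWalk.IrreducibleOn (KilledWalk.walkKernel μ) Set.univ)
    (hmean : KilledWalk.meanJump μ ≠ 0)
    (hirr_quadrant : KilledWalk.IrreducibleOn
      (KilledWalk.killedKernel μ KilledWalk.quadrant) KilledWalk.quadrant)
    (hexp : ∀ a : EuclideanSpace ℝ (Fin 2), Summable (KilledWalk.expTerm μ a))
    (haper_fst : KilledWalk.Aperiodic (KilledWalk.walkKernel (μ.map Prod.fst)))
    (haper_snd : KilledWalk.Aperiodic (KilledWalk.walkKernel (μ.map Prod.snd)))
    (z₀ : ℤ × ℤ) (hz₀ : z₀ ∈ KilledWalk.halfPlane)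
    (u : ℕ → ℤ × ℤ) (hu : ∀ n, u n ∈ KilledWalk.quadrant)
    (hu_norm : Tendsto (fun n => ‖KilledWalk.toPlane (u n)‖) atTop atTop)
    (hu_dir : Tendsto (fun n => ‖KilledWalk.toPlane (u n)‖⁻¹ • KilledWalk.toPlane (u n)) atTop
      (𝓝 !₂[(1 : ℝ), 0])) :
    (∀ z ∈ KilledWalk.halfPlane, ∀ z' ∈ KilledWalk.halfPlane,
      0 < KilledWalk.greenHalfPlane μ z z' ∧ KilledWalk.greenHalfPlane μ z z' < ⊤) ∧
    ∀ σ : ℝ, 0 < σ → ∃ C : ℝ, 0 < C ∧ ∃ δ : ℝ, 0 < δ ∧ ∃ N : ℕ, 0 < N ∧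
      ∀ n, N ≤ n → ∀ z ∈ KilledWalk.halfPlane,
        ‖KilledWalk.toPlane z‖ < δ * ‖KilledWalk.toPlane (u n)‖ →
        KilledWalk.greenHalfPlane μ z (u n) / KilledWalk.greenHalfPlane μ z₀ (u n) ≤
          ENNReal.ofReal (C * Real.exp
            (inner ℝ (KilledWalk.normalPoint μ !₂[(1 : ℝ), 0]) (KilledWalk.toPlane z)
              + σ * ‖KilledWalk.toPlane z‖)) := by
  open KilledWalk in
  refine ⟨fun z hz z' hz' => ⟨greenHalfPlane_pos hirr_quadrant hz hz', ?_⟩, fun σ hσ => ?_⟩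
  · obtain ⟨b, hb⟩ := exists_jumpGen_lt_one hexp hmean
    refine greenHalfPlane_lt_top (s := b 0) (t := b 1) ?_ z z'
    rw [genFun_eq hexp]
    exact ENNReal.ofReal_lt_one.2 hb
  obtain ⟨ha, c, hc, hg⟩ := normalPoint_spec hexp hmean hirr_quadrant
  set a := normalPoint μ !₂[(1 : ℝ), 0]
  have ha' : genFun μ (a 0) (a 1) = 1 := by
    rw [genFun_eq hexp, ha, ENNReal.ofReal_one]
  obtain ⟨C', hdrift⟩ := horizontalDrift_tilt hexp hirr_quadrant ha' hc hg
  obtain ⟨A, δ, hδ, R, hmain⟩ := hdrift.exists_green_le_mul hz₀ (half_pos hσ)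
  have hcoord : ∀ i, Tendsto (fun n => ‖toPlane (u n)‖⁻¹ * toPlane (u n) i) atTop
      (𝓝 (!₂[(1 : ℝ), 0] i)) := fun i =>
    ((EuclideanSpace.proj (𝕜 := ℝ) i).continuous.tendsto _).comp hu_dir
  have h1 : ∀ᶠ n in atTop, 1 / 2 < ‖toPlane (u n)‖⁻¹ * toPlane (u n) 0 :=
    (hcoord 0).eventually (lt_mem_nhds (by simp; norm_num))
  have h2 : ∀ᶠ n in atTop, ‖toPlane (u n)‖⁻¹ * toPlane (u n) 1 < δ :=
    (hcoord 1).eventually (gt_mem_nhds (by simpa using hδ))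
  obtain ⟨N, hN⟩ := eventually_atTop.1 (h1.and (h2.and (hu_norm.eventually_ge_atTop (max R 1))))
  refine ⟨Real.exp (A - (a 0 * z₀.1 + a 1 * z₀.2)), Real.exp_pos _, δ, hδ, N + 1, N.succ_pos,
    fun n hn z hz hzn => ?_⟩
  obtain ⟨e1, e2, e3⟩ := hN n (by omega)
  set m := ‖toPlane (u n)‖ with hm
  have hm1 : 1 ≤ m := (le_max_right _ _).trans e3
  have hm0 : 0 < m := by linarith
  have hu1 : toPlane (u n) 0 = (u n).1 := by simp [toPlane]
  have hu2 : toPlane (u n) 1 = (u n).2 := by simp [toPlane]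
  rw [hu1, inv_mul_eq_div, lt_div_iff₀ hm0] at e1
  rw [hu2, inv_mul_eq_div, div_lt_iff₀ hm0] at e2
  have hz1 := abs_fst_le_norm_toPlane z
  have hz2 := abs_snd_le_norm_toPlane z
  have key := hmain (u n) (hu n).2 m ((le_max_left _ _).trans e3) hm0.le (by linarith)
    ((le_abs_self _).trans (abs_fst_le_norm_toPlane (u n))) e2.le z hz (hz1.trans hzn.le)
    ((le_abs_self _).trans (hz2.trans hzn.le))
  refine ENNReal.div_le_of_le_mul ?_
  have t1 := greenHalfPlane_tilt ha' z (u n)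
  have t2 := greenHalfPlane_tilt ha' z₀ (u n)
  have hne := expW_ne_zero (a 0) (a 1) (u n)
  have htop := expW_ne_top (a 0) (a 1) (u n)
  rw [← ENNReal.mul_le_mul_iff_left hne htop, ← t1, mul_assoc, ← t2]
  refine (mul_le_mul_left key _).trans ?_
  rw [mul_comm (greenHalfPlane _ z₀ _) (expW _ _ z₀), ← mul_assoc, mul_right_comm]
  refine mul_le_mul_left ?_ _
  rw [expW, expW, ← ENNReal.ofReal_mul (Real.exp_nonneg _), ← ENNReal.ofReal_mul (by positivity),
    ← Real.exp_add, ← Real.exp_add, ← Real.exp_add]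
  refine ENNReal.ofReal_le_ofReal (Real.exp_le_exp.2 ?_)
  rw [inner_toPlane]
  have h3 : σ / 2 * |(z.1 : ℝ)| ≤ σ / 2 * ‖toPlane z‖ := by gcongr
  have h4 : σ / 2 * (z.2 : ℝ) ≤ σ / 2 * ‖toPlane z‖ := by
    gcongr
    exact (le_abs_self _).trans hz2
  linarith
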